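/- Let $k,m\in\mathbb N$ (the bipartite Bell scenario $\Gamma=(k,m)$ with $k$ measurement settings per party and $m$ outcomes per measurement). Consider arrays $P=(P(a,b|x,y))_{a,b\in[m],\,x,y\in[k]}\in\mathbb R^{k^2m^2}$. An $m$-outcome POVM on a complex Hilbert space $\mathcal H$ is a tuple $(A_1,\dots,A_m)$ of positive bounded operators on $\mathcal H$ with $\sum_a A_a=\mathbb 1$. * $\mathcal Q_\otimes(\Gamma)$ is the set of all $P$ for which there are Hilbert spaces $\mathcal H_A,\mathcal H_B$, POVMs $(A^x_a)_{a\in[m]}$ on $\mathcal H_A$ for each $x\in[k]$ and $(B^y_b)_{b\in[m]}$ on $\mathcal H_B$ for each $y\in[k]$, and a unit vector $\psi$ in the Hilbert space tensor product $\mathcal H_A\otimes\mathcal H_B$ with $P(a,b|x,y)=\langle\psi,(A^x_a\otimes B^y_b)\psi\rangle$ for all $a,b,x,y$. * $\mathcal Q_c(\Gamma)$ is the set of all $P$ for which there are one Hilbert space $\mathcal H$, POVMs $(A^x_a)_{a\in[m]}$ and $(B^y_b)_{b\in[m]}$ on $\mathcal H$ for all $x,y\in[k]$ with $A^x_aB^y_b=B^y_bA^x_a$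 for all $a,b,x,y$, and a unit vector $\psi\in\mathcal H$ with $P(a,b|x,y)=\langle\psi,A^x_aB^y_b\psi\rangle$ for all $a,b,x,y$. Let $\mathbb F_2$ be the free group on two generators, and let $C^*(\mathbb F_2)$ be its maximal group $C^*$-algebra, i.e. the completion of the group algebra $\mathbb C[\mathbb F_2]$ in the norm $\|x\|=\sup_\pi\|\pi(x)\|$, with $\pi$ ranging over all unitary representations. For unital $C^*$-algebras $A,B$ let $A\otimes_{\max}B$ be the completion of the algebraic tensor product $A\otimes_{\mathrm{alg}}B$ in the norm $\|x\|_{\max}=\sup_\pi\|\pi(x)\|$ over all $*$-representations $\pi$ of $A\otimes_{\mathrm{alg}}B$ on Hilbert spaces, and let $A\otimes_{\min}B$ be its completion in the spatial norm $\|x\|_{\min}=\sup_{\pi_A,\pi_B}\|(\pi_A\otimes\pi_B)(x)\|$ over all $*$-representations $\pi_A$ of $A$ and $\pi_B$ of $B$ on Hilbert spaces (equivalently, the norm given by any pair of faithful representations). **Theorem.** Suppose that Kirchberg's QWEP conjecture $$C^*(\mathbb F_2)\otimes_{\min}C^*(\mathbb F_2)=C^*(\mathbb F_2)\otimes_{\max}C^*(\mathbb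 F_2)$$ holds, i.e. the identity of $C^*(\mathbb F_2)\otimes_{\mathrm{alg}}C^*(\mathbb F_2)$ extends to an isomorphism between these two $C^*$-algebras. Then for every bipartite Bell scenario $\Gamma=(k,m)$, $$\overline{\mathcal Q_\otimes(\Gamma)}=\mathcal Q_c(\Gamma),$$ where the closure is taken in $\mathbb R^{k^2m^2}$. -/

import Mathlib

open scoped TensorProduct InnerProductSpace ComplexConjugate
open UniformSpace

noncomputable section

universe u

/-! ### Hilbert space tensor products -/

/-- The Hilbert space tensor product of `H` and `K`: the completion of the algebraic tensor product
with respect to `⟪x ⊗ y, x' ⊗ y'⟫ = ⟪x, x'⟫ ⟪y, y'⟫`. -/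
def HilbertTensor (H K : Type*) [NormedAddCommGroup H] [InnerProductSpace ℂ H]
    [NormedAddCommGroup K] [InnerProductSpace ℂ K] : Type _ :=
  Completion (H ⊗[ℂ] K)

section OpTensor

variable {H K : Type*} [NormedAddCommGroup H] [InnerProductSpace ℂ H]
  [NormedAddCommGroup K] [InnerProductSpace ℂ K]

instance : NormedAddCommGroup (HilbertTensor H K) :=
  inferInstanceAs (NormedAddCommGroup (Completion (H ⊗[ℂ] K)))

instance : InnerProductSpace ℂ (HilbertTensor H K) :=
  inferInstanceAs (InnerProductSpace ℂ (Completion (H ⊗[ℂ] K)))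

instance : CompleteSpace (HilbertTensor H K) :=
  inferInstanceAs (CompleteSpace (Completion (H ⊗[ℂ] K)))

variable (H K) in
/-- The isometric inclusion of the algebraic tensor product in the Hilbert space tensor product. -/
def toHilbertTensor : H ⊗[ℂ] K →ₗᵢ[ℂ] HilbertTensor H K :=
  (Completion.toComplₗᵢ : H ⊗[ℂ] K →ₗᵢ[ℂ] Completion (H ⊗[ℂ] K))

theorem denseRange_toHilbertTensor : DenseRange (toHilbertTensor H K) :=
  Completion.denseRange_coe (α := H ⊗[ℂ] K)

@[elab_as_elim]
theorem hilbertTensor_induction {P : HilbertTensor H K → Prop} (z : HilbertTensor H K)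
    (hc : IsClosed {z | P z}) (h : ∀ w : H ⊗[ℂ] K, P (toHilbertTensor H K w)) : P z :=
  denseRange_toHilbertTensor.induction_on z hc h

/-- The bounded operator `S ⊗ T` on the Hilbert space tensor product. -/
def opTensor (S : H →L[ℂ] H) (T : K →L[ℂ] K) : HilbertTensor H K →L[ℂ] HilbertTensor H K :=
  (TensorProduct.mapL S T).completion

@[simp]
theorem opTensor_coe (S : H →L[ℂ] H) (T : K →L[ℂ] K) (z : H ⊗[ℂ] K) :
    opTensor S T (toHilbertTensor H K z) =
      toHilbertTensor H K (TensorProduct.map S.toLinearMap T.toLinearMap z) := by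
  rw [← TensorProduct.mapL_apply]
  exact (TensorProduct.mapL S T).completion_apply_coe z

/-- Bounded operators on a Hilbert tensor product which agree on algebraic tensors are equal. -/
theorem opTensor_ext {F G : HilbertTensor H K →L[ℂ] HilbertTensor H K}
    (h : ∀ z : H ⊗[ℂ] K, F (toHilbertTensor H K z) = G (toHilbertTensor H K z)) : F = G := by
  ext z
  exact hilbertTensor_induction z (isClosed_eq F.continuous G.continuous) h

theorem opTensor_add_left (S S' : H →L[ℂ] H) (T : K →L[ℂ] K) :
    opTensor (S + S') T = opTensor S T + opTensor S' T :=
  opTensor_ext fun z => by simp [TensorProduct.map_add_left]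

theorem opTensor_add_right (S : H →L[ℂ] H) (T T' : K →L[ℂ] K) :
    opTensor S (T + T') = opTensor S T + opTensor S T' :=
  opTensor_ext fun z => by simp [TensorProduct.map_add_right]

theorem opTensor_smul_left (c : ℂ) (S : H →L[ℂ] H) (T : K →L[ℂ] K) :
    opTensor (c • S) T = c • opTensor S T :=
  opTensor_ext fun z => by simp [TensorProduct.map_smul_left]

theorem opTensor_smul_right (c : ℂ) (S : H →L[ℂ] H) (T : K →L[ℂ] K) :
    opTensor S (c • T) = c • opTensor S T :=
  opTensor_ext fun z => by simp [TensorProduct.map_smul_right]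

theorem opTensor_one : opTensor (1 : H →L[ℂ] H) (1 : K →L[ℂ] K) = 1 :=
  opTensor_ext fun z => by simp

theorem opTensor_mul (S S' : H →L[ℂ] H) (T T' : K →L[ℂ] K) :
    opTensor (S * S') (T * T') = opTensor S T * opTensor S' T' :=
  opTensor_ext fun z => by
    induction z using TensorProduct.induction_on with
    | zero => simp
    | tmul x y => simp
    | add x y hx hy => rw [map_add, map_add, map_add, hx, hy]

theorem opTensor_star [CompleteSpace H] [CompleteSpace K] (S : H →L[ℂ] H) (T : K →L[ℂ] K) :
    opTensor (star S) (star T) = star (opTensor S T) := by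
  rw [ContinuousLinearMap.star_eq_adjoint (opTensor S T), ContinuousLinearMap.eq_adjoint_iff]
  intro x y
  refine hilbertTensor_induction x (isClosed_eq (by fun_prop) (by fun_prop)) fun x => ?_
  refine hilbertTensor_induction y (isClosed_eq (by fun_prop) (by fun_prop)) fun y => ?_
  rw [opTensor_coe, opTensor_coe, LinearIsometry.inner_map_map, LinearIsometry.inner_map_map]
  induction x using TensorProduct.induction_on with
  | zero => simp
  | add x x' hx hx' => simp only [map_add, inner_add_left, hx, hx']
  | tmul a b =>
    induction y using TensorProduct.induction_on with
    | zero => simp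
    | add y y' hy hy' => simp only [map_add, inner_add_right, hy, hy']
    | tmul c d =>
      simp [ContinuousLinearMap.star_eq_adjoint, ContinuousLinearMap.adjoint_inner_left]

end OpTensor

/-! ### Completion of a `*`-algebra with respect to a C⋆-seminorm -/

/-- A C⋆-seminorm on a complex unital `*`-algebra: a submultiplicative seminorm `p` with
`p (x⋆ x) = p x ^ 2`. -/
structure CStarSeminorm (𝒜 : Type u) [Ring 𝒜] [StarRing 𝒜] [Algebra ℂ 𝒜] extends
    Seminorm ℂ 𝒜 where
  mul_le' : ∀ x y, toFun (x * y) ≤ toFun x * toFun y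
  star_mul_self' : ∀ x, toFun (star x * x) = toFun x ^ 2

namespace CStarSeminorm

variable {𝒜 : Type u} [Ring 𝒜] [StarRing 𝒜] [Algebra ℂ 𝒜]

theorem toSeminorm_star (p : CStarSeminorm 𝒜) (x : 𝒜) :
    p.toSeminorm (star x) = p.toSeminorm x := by
  have key : ∀ y, p.toSeminorm y ≤ p.toSeminorm (star y) := by
    intro y
    have h1 : p.toSeminorm (star y * y) = p.toSeminorm y ^ 2 := p.star_mul_self' y
    have h2 : p.toSeminorm (star y * y) ≤ p.toSeminorm (star y) * p.toSeminorm y := p.mul_le' _ _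
    have h3 := apply_nonneg p.toSeminorm y
    have h4 := apply_nonneg p.toSeminorm (star y)
    by_contra! h
    nlinarith
  refine le_antisymm ?_ (key x)
  simpa using key (star x)

/-- The `*`-algebra `𝒜`, regarded as a seminormed space through `p`. -/
@[nolint unusedArguments]
def Space (_p : CStarSeminorm 𝒜) : Type u := 𝒜

variable (p : CStarSeminorm 𝒜)

instance : SeminormedRing p.Space where
  __ := (inferInstance : Ring 𝒜)
  __ := (p.toSeminorm.toAddGroupSeminorm.toSeminormedAddCommGroup : SeminormedAddCommGroup 𝒜)
  norm_mul_le := p.mul_le'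

instance : StarRing p.Space := (inferInstance : StarRing 𝒜)

theorem space_norm_def (x : p.Space) : ‖x‖ = p.toSeminorm x := rfl

instance : NormedAlgebra ℂ p.Space where
  __ := (inferInstance : Algebra ℂ 𝒜)
  norm_smul_le c x := (map_smul_eq_mul p.toSeminorm c x).le

instance [StarModule ℂ 𝒜] : StarModule ℂ p.Space := (inferInstance : StarModule ℂ 𝒜)

instance : NormedStarGroup p.Space where
  norm_star_le x := (p.toSeminorm_star x).le

/-- The completion of the `*`-algebra `𝒜` with respect to the C⋆-seminorm `p` (elements at distance
`0` being identified). It is a unital C⋆-algebra. -/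
def CStarCompletion : Type u := Completion p.Space

instance : NormedRing p.CStarCompletion := inferInstanceAs (NormedRing (Completion p.Space))

instance : CompleteSpace p.CStarCompletion := inferInstanceAs (CompleteSpace (Completion p.Space))

instance : Algebra ℂ p.CStarCompletion := inferInstanceAs (Algebra ℂ (Completion p.Space))

instance : NormedAlgebra ℂ p.CStarCompletion where
  norm_smul_le c x := norm_smul_le (β := Completion p.Space) c x

/-- The canonical map from the `*`-algebra `𝒜` to its completion. -/
def toCompletion (x : 𝒜) : p.CStarCompletion := Completion.coe' (α := p.Space) x

theorem norm_toCompletion (x : 𝒜) : ‖p.toCompletion x‖ = p.toSeminorm x :=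
  Completion.norm_coe (E := p.Space) x

theorem continuous_star_space : UniformContinuous (star : p.Space → p.Space) :=
  (starNormedAddGroupHom (E := p.Space)).uniformContinuous

instance : Star p.CStarCompletion := ⟨Completion.map (star : p.Space → p.Space)⟩

theorem star_toCompletion (x : 𝒜) : star (p.toCompletion x) = p.toCompletion (star x) :=
  Completion.map_coe p.continuous_star_space _

instance : ContinuousStar p.CStarCompletion := ⟨Completion.continuous_map⟩

theorem toCompletion_add (x y : 𝒜) :
    p.toCompletion (x + y) = p.toCompletion x + p.toCompletion y :=
  Completion.coe_add (α := p.Space) _ _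

theorem toCompletion_mul (x y : 𝒜) :
    p.toCompletion (x * y) = p.toCompletion x * p.toCompletion y :=
  Completion.coe_mul (α := p.Space) _ _

theorem toCompletion_one : p.toCompletion 1 = 1 :=
  Completion.coe_one (α := p.Space)

theorem toCompletion_smul (c : ℂ) (x : 𝒜) :
    p.toCompletion (c • x) = c • p.toCompletion x :=
  Completion.coe_smul (X := p.Space) c x

theorem denseRange_toCompletion : DenseRange p.toCompletion :=
  Completion.denseRange_coe (α := p.Space)

@[elab_as_elim]
theorem completion_induction {P : p.CStarCompletion → Prop} (x : p.CStarCompletion)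
    (hc : IsClosed {x | P x}) (h : ∀ a : 𝒜, P (p.toCompletion a)) : P x :=
  p.denseRange_toCompletion.induction_on x hc h

instance : StarRing p.CStarCompletion where
  star_involutive x := by
    refine p.completion_induction x (isClosed_eq (by fun_prop) (by fun_prop)) fun a => ?_
    rw [star_toCompletion, star_toCompletion, star_star]
  star_mul x y := by
    refine p.completion_induction x (isClosed_eq (by fun_prop) (by fun_prop)) fun a => ?_
    refine p.completion_induction y (isClosed_eq (by fun_prop) (by fun_prop)) fun b => ?_
    rw [← toCompletion_mul, star_toCompletion, star_toCompletion, star_toCompletion, star_mul,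
      toCompletion_mul]
  star_add x y := by
    refine p.completion_induction x (isClosed_eq (by fun_prop) (by fun_prop)) fun a => ?_
    refine p.completion_induction y (isClosed_eq (by fun_prop) (by fun_prop)) fun b => ?_
    rw [← toCompletion_add, star_toCompletion, star_toCompletion, star_toCompletion, star_add,
      toCompletion_add]

instance : CStarRing p.CStarCompletion where
  norm_mul_self_le x := by
    refine p.completion_induction x (isClosed_le (by fun_prop) (by fun_prop)) fun a => ?_
    rw [star_toCompletion, ← toCompletion_mul, norm_toCompletion, norm_toCompletion, ← sq]
    exact (p.star_mul_self' a).ge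

instance [StarModule ℂ 𝒜] : StarModule ℂ p.CStarCompletion where
  star_smul c x := by
    have h (d : ℂ) : Continuous fun y : p.CStarCompletion => d • y := continuous_const_smul d
    refine p.completion_induction x (isClosed_eq ((h c).star) ((h (star c)).comp continuous_star))
      fun a => ?_
    rw [← toCompletion_smul, star_toCompletion, star_toCompletion, star_smul, toCompletion_smul]

instance [StarModule ℂ 𝒜] : CStarAlgebra p.CStarCompletion where

end CStarSeminorm

/-! ### Representations on Hilbert spaces -/

/-- A (unital) `*`-representation of a unital `*`-algebra by bounded operators on a Hilbert space.
The Hilbert space lives in the universe of the algebra, which is enough room for every cyclic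
representation (up to unitary equivalence), hence for all suprema of operator norms below. -/
structure HilbertRep (𝒜 : Type u) [Ring 𝒜] [StarRing 𝒜] [Algebra ℂ 𝒜] where
  carrier : Type u
  [normedAddCommGroup : NormedAddCommGroup carrier]
  [innerProductSpace : InnerProductSpace ℂ carrier]
  [completeSpace : CompleteSpace carrier]
  hom : 𝒜 →⋆ₐ[ℂ] (carrier →L[ℂ] carrier)

attribute [instance] HilbertRep.normedAddCommGroup HilbertRep.innerProductSpace
  HilbertRep.completeSpace

namespace HilbertRep

section Seminorm

variable {𝒜 : Type u} [Ring 𝒜] [StarRing 𝒜] [Algebra ℂ 𝒜]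

instance : Inhabited (HilbertRep 𝒜) where
  default :=
    { carrier := PUnit
      hom :=
        { toFun := fun _ => 0
          map_one' := Subsingleton.elim _ _
          map_mul' := fun _ _ => Subsingleton.elim _ _
          map_zero' := Subsingleton.elim _ _
          map_add' := fun _ _ => Subsingleton.elim _ _
          commutes' := fun _ => Subsingleton.elim _ _
          map_star' := fun _ => Subsingleton.elim _ _ } }

/-- The C⋆-seminorm `x ↦ sup_i ‖π_i x‖` given by a pointwise bounded family of representations. -/
def supSeminorm {ι : Type*} [Nonempty ι] (R : ι → HilbertRep 𝒜)
    (hR : ∀ x, BddAbove (Set.range fun i => ‖(R i).hom x‖)) : CStarSeminorm 𝒜 where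
  toFun x := ⨆ i, ‖(R i).hom x‖
  map_zero' := by simp
  add_le' x y := ciSup_le fun i => by
    rw [map_add]
    exact (norm_add_le _ _).trans (add_le_add (le_ciSup (hR x) i) (le_ciSup (hR y) i))
  neg' x := by simp
  smul' c x := by
    simp only [map_smul, norm_smul]
    exact (Real.mul_iSup_of_nonneg (norm_nonneg c) _).symm
  mul_le' x y := ciSup_le fun i => by
    rw [map_mul]
    exact (norm_mul_le _ _).trans (mul_le_mul (le_ciSup (hR x) i) (le_ciSup (hR y) i)
      (norm_nonneg _) (Real.iSup_nonneg fun _ => norm_nonneg _))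
  star_mul_self' x := by
    have h0 : 0 ≤ ⨆ i, ‖(R i).hom x‖ := Real.iSup_nonneg fun _ => norm_nonneg _
    have h1 : ∀ i, ‖(R i).hom (star x * x)‖ = ‖(R i).hom x‖ ^ 2 := fun i => by
      rw [map_mul, map_star, CStarRing.norm_star_mul_self, sq]
    apply le_antisymm
    · refine ciSup_le fun i => ?_
      rw [h1]
      exact pow_le_pow_left₀ (norm_nonneg _) (le_ciSup (hR x) i) 2
    · rw [← Real.le_sqrt h0 (Real.iSup_nonneg fun _ => norm_nonneg _)]
      refine ciSup_le fun i => Real.le_sqrt_of_sq_le ?_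
      rw [← h1]
      exact le_ciSup (hR (star x * x)) i

end Seminorm

section TensorRep

variable {A B : Type u} [CStarAlgebra A] [CStarAlgebra B]

/-- The linear map `a ⊗ b ↦ π a ⊗ ρ b` from the algebraic tensor product of two C⋆-algebras to the
bounded operators on the Hilbert space tensor product. -/
def tensorLinearMap (π : HilbertRep A) (ρ : HilbertRep B) :
    A ⊗[ℂ] B →ₗ[ℂ]
      (HilbertTensor π.carrier ρ.carrier →L[ℂ] HilbertTensor π.carrier ρ.carrier) :=
  TensorProduct.lift (LinearMap.mk₂ ℂ (fun a b => opTensor (π.hom a) (ρ.hom b))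
    (fun a a' b => by rw [map_add, opTensor_add_left])
    (fun c a b => by rw [map_smul, opTensor_smul_left])
    (fun a b b' => by rw [map_add, opTensor_add_right])
    (fun c a b => by rw [map_smul, opTensor_smul_right]))

theorem tensorLinearMap_tmul (π : HilbertRep A) (ρ : HilbertRep B) (a : A) (b : B) :
    tensorLinearMap π ρ (a ⊗ₜ b) = opTensor (π.hom a) (ρ.hom b) := rfl

theorem tensorLinearMap_mul_tmul (π : HilbertRep A) (ρ : HilbertRep B) (a a' : A) (b b' : B) :
    tensorLinearMap π ρ ((a * a') ⊗ₜ (b * b')) =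
      tensorLinearMap π ρ (a ⊗ₜ b) * tensorLinearMap π ρ (a' ⊗ₜ b') := by
  rw [tensorLinearMap_tmul, tensorLinearMap_tmul, tensorLinearMap_tmul, map_mul, map_mul,
    opTensor_mul]

theorem tensorLinearMap_one (π : HilbertRep A) (ρ : HilbertRep B) :
    tensorLinearMap π ρ (1 ⊗ₜ 1) = 1 := by
  rw [tensorLinearMap_tmul, map_one, map_one, opTensor_one]

theorem tensorLinearMap_star (π : HilbertRep A) (ρ : HilbertRep B) (x : A ⊗[ℂ] B) :
    tensorLinearMap π ρ (star x) = star (tensorLinearMap π ρ x) := by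
  induction x using TensorProduct.induction_on with
  | zero => rw [star_zero, map_zero, star_zero]
  | tmul a b =>
    rw [TensorProduct.star_tmul, tensorLinearMap_tmul, tensorLinearMap_tmul, map_star, map_star,
      opTensor_star]
  | add x y hx hy => rw [star_add, map_add, map_add, star_add, hx, hy]

/-- The tensor product representation `(π ⊗ ρ)(a ⊗ b) = π a ⊗ ρ b` of the algebraic tensor product
of two C⋆-algebras on the Hilbert space tensor product. -/
def tensor (π : HilbertRep A) (ρ : HilbertRep B) : HilbertRep (A ⊗[ℂ] B) where
  carrier := HilbertTensor π.carrier ρ.carrier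
  hom :=
    { Algebra.TensorProduct.algHomOfLinearMapTensorProduct (tensorLinearMap π ρ)
        (tensorLinearMap_mul_tmul π ρ) (tensorLinearMap_one π ρ) with
      map_star' := tensorLinearMap_star π ρ }

theorem tensor_hom_tmul (π : HilbertRep A) (ρ : HilbertRep B) (a : A) (b : B) :
    (π.tensor ρ).hom (a ⊗ₜ b) = opTensor (π.hom a) (ρ.hom b) := rfl

/-- The representations of an algebraic tensor product of C⋆-algebras are pointwise bounded. -/
theorem exists_bound_tensor (x : A ⊗[ℂ] B) :
    ∃ C : ℝ, ∀ π : HilbertRep (A ⊗[ℂ] B), ‖π.hom x‖ ≤ C := by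
  induction x using TensorProduct.induction_on with
  | zero => exact ⟨0, fun π => by simp⟩
  | add x y hx hy =>
    obtain ⟨C, hC⟩ := hx
    obtain ⟨D, hD⟩ := hy
    exact ⟨C + D, fun π => by
      rw [map_add]; exact (norm_add_le _ _).trans (add_le_add (hC π) (hD π))⟩
  | tmul a b =>
    refine ⟨‖a‖ * ‖b‖, fun π => ?_⟩
    let f : A →⋆ₐ[ℂ] (π.carrier →L[ℂ] π.carrier) :=
      { π.hom.toAlgHom.comp Algebra.TensorProduct.includeLeft with
        map_star' := fun a => by
          change π.hom (star a ⊗ₜ 1) = star (π.hom (a ⊗ₜ 1))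
          rw [← map_star, TensorProduct.star_tmul, star_one] }
    let g : B →⋆ₐ[ℂ] (π.carrier →L[ℂ] π.carrier) :=
      { π.hom.toAlgHom.comp Algebra.TensorProduct.includeRight with
        map_star' := fun b => by
          change π.hom (1 ⊗ₜ star b) = star (π.hom (1 ⊗ₜ b))
          rw [← map_star, TensorProduct.star_tmul, star_one] }
    have h : π.hom (a ⊗ₜ[ℂ] b) = f a * g b := by
      change π.hom (a ⊗ₜ b) = π.hom (a ⊗ₜ 1) * π.hom (1 ⊗ₜ b)
      rw [← map_mul, Algebra.TensorProduct.tmul_mul_tmul, mul_one, one_mul]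
    rw [h]
    exact (norm_mul_le _ _).trans (mul_le_mul (NonUnitalStarAlgHom.norm_apply_le f a)
      (NonUnitalStarAlgHom.norm_apply_le g b) (norm_nonneg _) (norm_nonneg _))

end TensorRep

end HilbertRep

/-! ### Minimal and maximal tensor products of C⋆-algebras -/

section TensorProducts

variable (A B : Type u) [CStarAlgebra A] [CStarAlgebra B]

/-- The maximal C⋆-norm on `A ⊗ B`: the supremum of `‖π x‖` over all representations `π` of the
algebraic tensor product. -/
def maxTensorNorm : CStarSeminorm (A ⊗[ℂ] B) :=
  HilbertRep.supSeminorm (ι := HilbertRep (A ⊗[ℂ] B)) id fun x =>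
    let ⟨C, hC⟩ := HilbertRep.exists_bound_tensor x
    ⟨C, by rintro _ ⟨π, rfl⟩; exact hC π⟩

/-- The minimal (spatial) C⋆-norm on `A ⊗ B`: the supremum of `‖(π ⊗ ρ) x‖` over all
representations `π` of `A` and `ρ` of `B`; the operator `(π ⊗ ρ) x` acts on the Hilbert space tensor
product. The supremum is attained at every pair of faithful representations. -/
def minTensorNorm : CStarSeminorm (A ⊗[ℂ] B) :=
  HilbertRep.supSeminorm (ι := HilbertRep A × HilbertRep B) (fun i => i.1.tensor i.2) fun x =>
    let ⟨C, hC⟩ := HilbertRep.exists_bound_tensor x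
    ⟨C, by rintro _ ⟨i, rfl⟩; exact hC _⟩

/-- The maximal tensor product C⋆-algebra. -/
abbrev MaxTensor : Type u := (maxTensorNorm A B).CStarCompletion

/-- The minimal tensor product C⋆-algebra. -/
abbrev MinTensor : Type u := (minTensorNorm A B).CStarCompletion

/-- `A ⊗_min B = A ⊗_max B`: the identity of the algebraic tensor product extends to an isomorphism
of C⋆-algebras. -/
def MinTensorEqMaxTensor : Prop :=
  ∃ e : MinTensor A B ≃⋆ₐ[ℂ] MaxTensor A B, ∀ x : A ⊗[ℂ] B,
    e ((minTensorNorm A B).toCompletion x) = (maxTensorNorm A B).toCompletion x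

end TensorProducts

/-! ### Maximal group C⋆-algebras -/

section GroupAlgebra

variable {G : Type u} [Group G]

/-- The involution `(∑ x_g δ_g)⋆ = ∑ conj x_g δ_{g⁻¹}` on the group algebra. -/
instance : Star (MonoidAlgebra ℂ G) where
  star x := (x.map (starRingEnd ℂ).toAddMonoidHom).mapDomain (·⁻¹)

theorem groupAlgebra_star_single (g : G) (c : ℂ) :
    star (MonoidAlgebra.single g c) = MonoidAlgebra.single g⁻¹ (conj c) := by
  simp [star]

theorem groupAlgebra_star_add (x y : MonoidAlgebra ℂ G) : star (x + y) = star x + star y := by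
  simp [star, MonoidAlgebra.map_add, MonoidAlgebra.mapDomain_add]

theorem groupAlgebra_star_zero : star (0 : MonoidAlgebra ℂ G) = 0 := by
  simp [star, MonoidAlgebra.map_zero]

instance : StarRing (MonoidAlgebra ℂ G) where
  star_add := groupAlgebra_star_add
  star_involutive x := by
    induction x using MonoidAlgebra.induction_linear with
    | zero => simp only [groupAlgebra_star_zero]
    | add x y hx hy => rw [groupAlgebra_star_add, groupAlgebra_star_add, hx, hy]
    | single g c => simp [groupAlgebra_star_single]
  star_mul x y := by
    induction x using MonoidAlgebra.induction_linear with
    | zero => simp [groupAlgebra_star_zero]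
    | add x x' hx hx' => rw [add_mul, groupAlgebra_star_add, groupAlgebra_star_add, hx, hx', mul_add]
    | single g c =>
      induction y using MonoidAlgebra.induction_linear with
      | zero => simp [groupAlgebra_star_zero]
      | add y y' hy hy' =>
        rw [mul_add, groupAlgebra_star_add, groupAlgebra_star_add, hy, hy', add_mul]
      | single h d =>
        simp [groupAlgebra_star_single, MonoidAlgebra.single_mul_single, mul_comm]

instance : StarModule ℂ (MonoidAlgebra ℂ G) where
  star_smul c x := by
    induction x using MonoidAlgebra.induction_linear with
    | zero => simp
    | add x y hx hy => rw [smul_add, star_add, star_add, hx, hy, smul_add]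
    | single g d => simp [groupAlgebra_star_single]

/-- The representations of the group algebra are pointwise bounded. -/
theorem exists_bound_groupAlgebra (x : MonoidAlgebra ℂ G) :
    ∃ C : ℝ, ∀ π : HilbertRep (MonoidAlgebra ℂ G), ‖π.hom x‖ ≤ C := by
  induction x using MonoidAlgebra.induction_linear with
  | zero => exact ⟨0, fun π => by simp⟩
  | add x y hx hy =>
    obtain ⟨C, hC⟩ := hx
    obtain ⟨D, hD⟩ := hy
    exact ⟨C + D, fun π => by
      rw [map_add]; exact (norm_add_le _ _).trans (add_le_add (hC π) (hD π))⟩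
  | single g c =>
    refine ⟨‖c‖, fun π => ?_⟩
    have h1 : ‖π.hom (MonoidAlgebra.single g c)‖ * ‖π.hom (MonoidAlgebra.single g c)‖
        ≤ ‖c‖ * ‖c‖ := by
      rw [← CStarRing.norm_star_mul_self, ← map_star, ← map_mul, groupAlgebra_star_single,
        MonoidAlgebra.single_mul_single, inv_mul_cancel]
      have h2 : (MonoidAlgebra.single 1 (conj c * c) : MonoidAlgebra ℂ G) = (conj c * c) • 1 := by
        simp [MonoidAlgebra.one_def]
      rw [h2, map_smul, map_one, norm_smul, norm_mul, RCLike.norm_conj]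
      exact mul_le_of_le_one_right (by positivity) ContinuousLinearMap.norm_id_le
    exact abs_le_of_sq_le_sq' (by nlinarith) (norm_nonneg c) |>.2

variable (G)

/-- The maximal C⋆-norm on the group algebra `ℂ[G]`: the supremum of `‖π x‖` over all
`*`-representations of `ℂ[G]`, that is, over all unitary representations of `G`. -/
def groupAlgebraMaxNorm : CStarSeminorm (MonoidAlgebra ℂ G) :=
  HilbertRep.supSeminorm (ι := HilbertRep (MonoidAlgebra ℂ G)) id fun x =>
    let ⟨C, hC⟩ := exists_bound_groupAlgebra x
    ⟨C, by rintro _ ⟨π, rfl⟩; exact hC π⟩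

/-- The maximal group C⋆-algebra `C⋆(G)` of a discrete group `G`. -/
abbrev MaxGroupCStar : Type u := (groupAlgebraMaxNorm G).CStarCompletion

end GroupAlgebra

/-- Kirchberg's QWEP conjecture: `C⋆(F₂) ⊗_min C⋆(F₂) = C⋆(F₂) ⊗_max C⋆(F₂)`, where `F₂` is the free
group on two generators. -/
def QWEPConjecture : Prop :=
  MinTensorEqMaxTensor (MaxGroupCStar (FreeGroup (Fin 2))) (MaxGroupCStar (FreeGroup (Fin 2)))

/-! ### Quantum correlations

All Hilbert spaces here are in `Type`. This is no restriction: a correlation only involves finitely many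
operators and one vector, so it is always realized on separable Hilbert spaces. -/

/-- A POVM with `m` outcomes on a Hilbert space. -/
def IsPOVM {H : Type*} [NormedAddCommGroup H] [InnerProductSpace ℂ H] {m : ℕ}
    (A : Fin m → H →L[ℂ] H) : Prop :=
  (∀ a, (A a).IsPositive) ∧ ∑ a, A a = 1

/-- The space `ℝ^(k²m²)` of all arrays `P a b x y` (standing for `P(a,b|x,y)`), with outcomes
`a, b` and settings `x, y`, equipped with its usual topology. -/
abbrev BellArray (k m : ℕ) : Type := Fin m → Fin m → Fin k → Fin k → ℝ

/-- `Q_⊗`: the correlations `P(a,b|x,y) = ⟪ψ, (A^x_a ⊗ B^y_b) ψ⟫`, where `A^x` and `B^y` are POVMs on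
Hilbert spaces `HA` and `HB` and `ψ` is a unit vector of the Hilbert tensor product. -/
def tensorCorrelations (k m : ℕ) : Set (BellArray k m) :=
  {P | ∃ (HA : Type) (_ : NormedAddCommGroup HA) (_ : InnerProductSpace ℂ HA) (_ : CompleteSpace HA)
      (HB : Type) (_ : NormedAddCommGroup HB) (_ : InnerProductSpace ℂ HB) (_ : CompleteSpace HB)
      (A : Fin k → Fin m → HA →L[ℂ] HA) (B : Fin k → Fin m → HB →L[ℂ] HB)
      (ψ : HilbertTensor HA HB),
      (∀ x, IsPOVM (A x)) ∧ (∀ y, IsPOVM (B y)) ∧ ‖ψ‖ = 1 ∧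
      ∀ a b x y, (P a b x y : ℂ) = ⟪ψ, opTensor (A x a) (B y b) ψ⟫_ℂ}

/-- `Q_c`: the correlations `P(a,b|x,y) = ⟪ψ, A^x_a B^y_b ψ⟫`, where `A^x` and `B^y` are POVMs on a
single Hilbert space `H`, each `A^x_a` commutes with each `B^y_b`, and `ψ` is a unit vector. -/
def commutingCorrelations (k m : ℕ) : Set (BellArray k m) :=
  {P | ∃ (H : Type) (_ : NormedAddCommGroup H) (_ : InnerProductSpace ℂ H) (_ : CompleteSpace H)
      (A B : Fin k → Fin m → H →L[ℂ] H) (ψ : H),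
      (∀ x, IsPOVM (A x)) ∧ (∀ y, IsPOVM (B y)) ∧
      (∀ x y a b, A x a * B y b = B y b * A x a) ∧ ‖ψ‖ = 1 ∧
      ∀ a b x y, (P a b x y : ℂ) = ⟪ψ, A x a (B y b ψ)⟫_ℂ}

end

/-!
Commuting correlations form a closed set that contains the tensor product correlations. Containment
is clear: `A ⊗ 1` and `1 ⊗ B` commute. For closedness, let `P n → P` be realized on Hilbert spaces
`H n` by unit vectors `ψ n`; the limit of the vector states along an ultrafilter is a state on the
C⋆-algebra of bounded sequences of operators, and its GNS representation realizes `P`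
(`isClosed_commutingCorrelations`).

Conversely, let `P` be a commuting correlation. By `exists_universal_povm` there are POVMs `E x` in
`C⋆(F₂)`, depending on the scenario only, such that `P(a,b|x,y) = ⟪ξ, σ (E x a ⊗ E y b) ξ⟫` for a
representation `σ` of `C⋆(F₂) ⊗ C⋆(F₂)` and a unit vector `ξ`. Three elementary devices replace the
usual embedding of free groups and lifting of completely positive maps:
* an operator `0 ≤ A ≤ 1` equals `(2 + U + U⋆) / 4` for a unitary `U` in its bicommutant
  (`exists_unitary_of_nonneg_of_le_one`), so that commuting POVMs turn into two commuting families of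
  unitaries;
* with `u` a cyclic shift and `v` the block diagonal unitary with blocks `U j`, the element
  `u⁻ʲ v uʲ` acts as `U j` on one fixed block (`freeRepLeft_freeConj`), so that two generators
  suffice for each party;
* the positive elements of `C⋆(F₂)` obtained in this way sum up to `1` only on that block, but a
  rational expression turns them into a POVM without changing their action there
  (`exists_isStarPOVM_of_tuple`).

Suppose that `P` is not in the closure of the tensor product correlations. This closure is convex
(`convex_tensorCorrelations`), so a hyperplane separates it from `P`. The hyperplane is given by a
selfadjoint element of the algebraic tensor product whose quadratic form is smaller in all product
representations `π ⊗ ρ` than at `ξ` in `σ`. After a shift by a multiple of `1` it has a smaller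
minimal than maximal norm, which contradicts the equality of the two
(`mem_closure_tensorCorrelations`).
-/

noncomputable section

universe u

/-! ### POVMs in `*`-algebras -/

/-- A POVM with `m` outcomes in an abstract `*`-algebra. Positivity of an element is witnessed
by an expression `z⋆ z + w⋆ w`, so that it is visibly preserved by every `*`-homomorphism. -/
def IsStarPOVM {𝒜 : Type*} [Ring 𝒜] [StarRing 𝒜] {m : ℕ} (E : Fin m → 𝒜) : Prop :=
  (∀ a, ∃ z w, E a = star z * z + star w * w) ∧ ∑ a, E a = 1

theorem isPositive_star_mul_self {H : Type*} [NormedAddCommGroup H] [InnerProductSpace ℂ H]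
    [CompleteSpace H] (T : H →L[ℂ] H) : (star T * T).IsPositive :=
  (ContinuousLinearMap.nonneg_iff_isPositive _).1 (star_mul_self_nonneg T)

theorem IsStarPOVM.isPOVM_map {𝒜 : Type*} [Ring 𝒜] [StarRing 𝒜] [Algebra ℂ 𝒜] {m : ℕ}
    {E : Fin m → 𝒜} (hE : IsStarPOVM E) {H : Type*} [NormedAddCommGroup H]
    [InnerProductSpace ℂ H] [CompleteSpace H] (π : 𝒜 →⋆ₐ[ℂ] (H →L[ℂ] H)) :
    IsPOVM fun a => π (E a) := by
  refine ⟨fun a => ?_, by rw [← map_sum, hE.2, map_one]⟩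
  obtain ⟨z, w, h⟩ := hE.1 a
  simp only [h, map_add, map_mul, map_star]
  exact (isPositive_star_mul_self _).add (isPositive_star_mul_self _)

theorem IsStarPOVM.star_eq {𝒜 : Type*} [Ring 𝒜] [StarRing 𝒜] {m : ℕ}
    {E : Fin m → 𝒜} (hE : IsStarPOVM E) (a : Fin m) : star (E a) = E a := by
  obtain ⟨z, w, h⟩ := hE.1 a
  simp [h]

theorem ContinuousLinearMap.IsPositive.exists_eq_star_mul_self {H : Type*} [NormedAddCommGroup H]
    [InnerProductSpace ℂ H] [CompleteSpace H] {T : H →L[ℂ] H} (hT : T.IsPositive) :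
    ∃ C : H →L[ℂ] H, T = star C * C :=
  CStarAlgebra.nonneg_iff_eq_star_mul_self.1 ((ContinuousLinearMap.nonneg_iff_isPositive _).2 hT)

theorem IsPOVM.isStarPOVM {H : Type*} [NormedAddCommGroup H] [InnerProductSpace ℂ H]
    [CompleteSpace H] {m : ℕ} {A : Fin m → H →L[ℂ] H} (hA : IsPOVM A) : IsStarPOVM A :=
  ⟨fun a => let ⟨C, hC⟩ := (hA.1 a).exists_eq_star_mul_self; ⟨C, 0, by simp [hC]⟩, hA.2⟩

theorem IsPOVM.le_one {H : Type*} [NormedAddCommGroup H] [InnerProductSpace ℂ H]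
    [CompleteSpace H] {m : ℕ} {A : Fin m → H →L[ℂ] H} (hA : IsPOVM A) (a : Fin m) : A a ≤ 1 := by
  rw [← hA.2]
  exact Finset.single_le_sum
    (fun i _ => (ContinuousLinearMap.nonneg_iff_isPositive _).2 (hA.1 i)) (Finset.mem_univ a)

/-! ### Normalizing a tuple to a POVM -/

/-- Every tuple `r` in a C⋆-algebra yields a POVM `E` which agrees with `a ↦ r_a⋆ r_a` wherever the
latter happens to be a POVM already: with `S = ∑ r_a⋆ r_a` one takes `E_a = R r_a⋆ r_a R`, where
`R = 2 (1 + S)⁻¹`, and adds the remainder `1 - R S R = ((1 - S) (1 + S)⁻¹)²` to the outcome `0`.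
On the subspace `range ι`, where `S` acts as `1`, so does `R`, and the remainder vanishes. -/
theorem exists_isStarPOVM_of_tuple {𝒜 : Type*} [CStarAlgebra 𝒜] {m : ℕ} [NeZero m]
    (r : Fin m → 𝒜) :
    ∃ E : Fin m → 𝒜, IsStarPOVM E ∧
      ∀ {H K : Type} [NormedAddCommGroup H] [InnerProductSpace ℂ H] [NormedAddCommGroup K]
        [InnerProductSpace ℂ K] [CompleteSpace K] (π : 𝒜 →⋆ₐ[ℂ] (K →L[ℂ] K)) (ι : H →ₗ[ℂ] K)
        (A : Fin m → H →L[ℂ] H), ∑ a, A a = 1 →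
        (∀ a h, π (star (r a) * r a) (ι h) = ι (A a h)) → ∀ a h, π (E a) (ι h) = ι (A a h) := by
  let _ := CStarAlgebra.spectralOrder 𝒜
  have _ := CStarAlgebra.spectralOrderedRing 𝒜
  set S : 𝒜 := ∑ a, star (r a) * r a with hS
  have hS0 : 0 ≤ S := Finset.sum_nonneg fun a _ => star_mul_self_nonneg (r a)
  have hSs : star S = S := (IsSelfAdjoint.of_nonneg hS0).star_eq
  have hU : IsUnit (1 + S) := CStarAlgebra.isUnit_of_le 1 (le_add_of_nonneg_right hS0)
  obtain ⟨V, hV⟩ := hU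
  set G : 𝒜 := ((V⁻¹ : 𝒜ˣ) : 𝒜) with hG
  have h1 : (1 + S) * G = 1 := by rw [← hV, hG, Units.mul_inv]
  have h2 : G * (1 + S) = 1 := by rw [← hV, hG, Units.inv_mul]
  have hGs : star G = G := by
    have h3 : star G * (1 + S) = 1 := by
      have := congrArg star h1
      simpa [hSs] using this
    calc star G = star G * ((1 + S) * G) := by rw [h1, mul_one]
      _ = G := by rw [← mul_assoc, h3, one_mul]
  refine ⟨fun a => star (r a * (2 * G)) * (r a * (2 * G)) +
    star (if a = 0 then (1 - S) * G else 0) * (if a = 0 then (1 - S) * G else 0),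
    ⟨fun a => ⟨_, _, rfl⟩, ?_⟩, ?_⟩
  · have e1 : ∀ a : Fin m, star (if a = 0 then (1 - S) * G else 0) *
        (if a = 0 then (1 - S) * G else 0) =
        if a = 0 then star ((1 - S) * G) * ((1 - S) * G) else 0 := fun a => by
      split_ifs <;> simp
    have e2 : ∀ a : Fin m, star (r a * (2 * G)) * (r a * (2 * G)) =
        G * (4 * (star (r a) * r a)) * G := fun a => by
      rw [star_mul, star_mul, hGs, star_ofNat]
      noncomm_ring
    rw [Finset.sum_add_distrib]
    simp only [e1, e2, Finset.sum_ite_eq', Finset.mem_univ, if_true]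
    rw [← Finset.sum_mul, ← Finset.mul_sum, ← Finset.mul_sum, ← hS, star_mul, hGs, star_sub,
      star_one, hSs]
    calc G * (4 * S) * G + G * (1 - S) * ((1 - S) * G)
        = (G * (1 + S)) * ((1 + S) * G) := by noncomm_ring
      _ = 1 := by rw [h1, h2, one_mul]
  · intro H K _ _ _ _ _ π ι A hA hr a h
    have hSι : ∀ h, π S (ι h) = ι h := fun h => by
      rw [hS, map_sum, sum_apply]
      simp only [hr]
      rw [← map_sum, ← sum_apply, hA, one_apply_eq_self]
    have hGι : ∀ h, π (2 * G) (ι h) = ι h := fun h => by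
      have e : π (1 + S) (ι h) = (2 : ℂ) • ι h := by
        rw [map_add, map_one, add_apply, hSι, one_apply_eq_self,
          two_smul]
      have e' : π G (π (1 + S) (ι h)) = ι h := by
        rw [← mul_apply_eq_comp, ← map_mul, h2, map_one, one_apply_eq_self]
      rw [two_mul, map_add, add_apply, ← two_smul ℂ, ← map_smul, ← e, e']
    have hDι : π ((1 - S) * (2 * G)) (ι h) = 0 := by
      rw [map_mul, mul_apply_eq_comp, hGι, map_sub, map_one,
        sub_apply, one_apply_eq_self, hSι, sub_self]
    have hDι' : π ((1 - S) * G) (ι h) = 0 := by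
      have e : (1 - S) * (2 * G) = (2 : ℂ) • ((1 - S) * G) := by
        rw [two_smul]; noncomm_ring
      rw [e, map_smul, smul_apply] at hDι
      exact (smul_eq_zero.1 hDι).resolve_left two_ne_zero
    have hD0 : π (if a = 0 then (1 - S) * G else 0) (ι h) = 0 := by
      split_ifs
      · exact hDι'
      · simp
    have e2 : star (r a * (2 * G)) * (r a * (2 * G)) =
        (2 * G) * ((star (r a) * r a) * (2 * G)) := by
      rw [star_mul, star_mul, hGs, star_ofNat]
      noncomm_ring
    change π (star (r a * (2 * G)) * (r a * (2 * G)) + star (if a = 0 then (1 - S) * G else 0) *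
      (if a = 0 then (1 - S) * G else 0)) (ι h) = ι (A a h)
    have hmul : ∀ x y v, π (x * y) v = π x (π y v) := fun x y v => by
      rw [map_mul, mul_apply_eq_comp]
    rw [e2, map_add, add_apply, hmul (2 * G), hmul (star (r a) * r a) (2 * G),
      hmul (star (ite _ _ _)), hGι, hr, hGι,
      hD0, map_zero, add_zero]

/-! ### Positive contractions from unitaries -/

/-- Every operator `0 ≤ A ≤ 1` is `(2 + U + U⋆) / 4` for a unitary `U` (with real part `2A - 1`),
which commutes with everything that commutes with `A`. -/
theorem exists_unitary_of_nonneg_of_le_one {𝒜 : Type*} [CStarAlgebra 𝒜] [PartialOrder 𝒜]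
    [StarOrderedRing 𝒜] {A : 𝒜} (h0 : 0 ≤ A) (h1 : A ≤ 1) :
    ∃ U : unitary 𝒜, (4⁻¹ : ℂ) • (2 + (U : 𝒜) + star (U : 𝒜)) = A ∧
      ∀ T, Commute A T → Commute (U : 𝒜) T := by
  set B : 𝒜 := 2 * A - 1 with hB
  have hAs : IsSelfAdjoint A := .of_nonneg h0
  have hBs : IsSelfAdjoint B := by
    have : IsSelfAdjoint (A + A - 1) := (hAs.add hAs).sub (.one _)
    rwa [hB, two_mul]
  have hsq : 0 ≤ 1 - B ^ 2 := by
    have e : 1 - B ^ 2 = (4 : ℝ) • (A - A ^ 2) := by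
      have : (4 : ℝ) • (A - A ^ 2) = 4 * (A - A ^ 2) := by
        rw [Algebra.smul_def, map_ofNat]
      rw [this, hB]; noncomm_ring
    rw [e]
    refine smul_nonneg (by norm_num) ?_
    have e2 : A - A ^ 2 = star A * (1 - A) * A + (1 - A) * A * star (1 - A) := by
      rw [star_sub, star_one, hAs.star_eq]; noncomm_ring
    rw [e2]
    exact add_nonneg (star_left_conjugate_nonneg (sub_nonneg.2 h1) _)
      (star_right_conjugate_nonneg h0 _)
  have hnorm : ‖B‖ ≤ 1 := by
    have h2 : ‖B ^ 2‖ ≤ 1 := by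
      rw [CStarAlgebra.norm_le_one_iff_of_nonneg _ (hBs.sq_nonneg)]
      exact sub_nonneg.1 hsq
    rw [sq, hBs.norm_mul_self] at h2
    exact (sq_le_one_iff₀ (norm_nonneg _)).1 h2
  refine ⟨⟨_, hBs.self_add_I_smul_cfcSqrt_sub_sq_mem_unitary B hnorm⟩, ?_, fun T hT => ?_⟩
  · have hq : star (CFC.sqrt (1 - B ^ 2)) = CFC.sqrt (1 - B ^ 2) :=
      (IsSelfAdjoint.of_nonneg (CFC.sqrt_nonneg _)).star_eq
    simp only [star_add, star_smul, hBs.star_eq, hq]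
    have : (star Complex.I) = -Complex.I := Complex.conj_I
    rw [this]
    have e : (2 : 𝒜) + (B + Complex.I • CFC.sqrt (1 - B ^ 2)) +
        (B + -Complex.I • CFC.sqrt (1 - B ^ 2)) = (4 : ℂ) • A := by
      have : (4 : ℂ) • A = 4 * A := by
        rw [Algebra.smul_def, map_ofNat]
      rw [this, neg_smul, hB, ← one_add_one_eq_two]
      noncomm_ring
    rw [e, smul_smul]
    norm_num
  · have hBT : Commute B T := ((Commute.ofNat_left 2 T).mul_left hT).sub_left (Commute.one_left _)
    have : Commute (CFC.sqrt (1 - B ^ 2)) T := by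
      rw [CFC.sqrt]
      exact Commute.cfcₙ_nnreal ((Commute.one_left _).sub_left (hBT.pow_left 2)) _
    exact hBT.add_left (this.smul_left _)

/-! ### Commuting correlations form a closed set -/

open scoped ComplexOrder ENNReal in
/-- Values of a state of a C⋆-algebra on products of commuting POVMs are commuting correlations,
by the GNS construction. -/
theorem mem_commutingCorrelations_of_state {𝒜 : Type} [CStarAlgebra 𝒜] [PartialOrder 𝒜]
    [StarOrderedRing 𝒜] {k m : ℕ} (φ : 𝒜 →ₚ[ℂ] ℂ) (hφ : φ 1 = 1) (A B : Fin k → Fin m → 𝒜)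
    (hA : ∀ x, IsStarPOVM (A x)) (hB : ∀ y, IsStarPOVM (B y))
    (hAB : ∀ x y a b, A x a * B y b = B y b * A x a) (P : BellArray k m)
    (hP : ∀ a b x y, (P a b x y : ℂ) = φ (A x a * B y b)) : P ∈ commutingCorrelations k m := by
  refine ⟨φ.GNS, inferInstance, inferInstance, inferInstance, fun x a => φ.gnsStarAlgHom (A x a),
    fun y b => φ.gnsStarAlgHom (B y b), ((φ.toPreGNS 1 : φ.PreGNS) : φ.GNS),
    fun x => (hA x).isPOVM_map _, fun y => (hB y).isPOVM_map _, fun x y a b => ?_, ?_,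
    fun a b x y => ?_⟩
  · rw [← map_mul, hAB, map_mul]
  · rw [Completion.norm_coe, PositiveLinearMap.preGNS_norm_def]
    simp [hφ]
  · rw [hP, ← mul_apply_eq_comp, ← map_mul]
    simp [PositiveLinearMap.preGNS_inner_def]

theorem CStarAlgebra.exists_eq_star_mul_self {𝒜 : Type*} [CStarAlgebra 𝒜] [PartialOrder 𝒜]
    [StarOrderedRing 𝒜] {T : 𝒜} (hT : 0 ≤ T) : ∃ C, T = star C * C :=
  CStarAlgebra.nonneg_iff_eq_star_mul_self.1 hT

open scoped ENNReal in
instance {I : Type*} {A : I → Type*} [∀ i, Nontrivial (A i)] [∀ i, CStarAlgebra (A i)] :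
    CStarAlgebra (lp A ∞) where

open scoped ComplexOrder ENNReal Topology in
open Filter in
/-- Given commuting correlations `P n → P`, realized on Hilbert spaces `H n`, the limit along an
ultrafilter of the vector states is a state on the C⋆-algebra of bounded sequences of operators, and
it realizes `P`. -/
theorem isClosed_commutingCorrelations (k m : ℕ) : IsClosed (commutingCorrelations k m) := by
  refine IsSeqClosed.isClosed fun Q P hQ hlim => ?_
  choose H i1 i2 i3 A B ψ hA hB hAB hψ hQP using hQ
  have hnt : ∀ n, Nontrivial (H n) := fun n => ⟨ψ n, 0, fun h => by simpa [h] using hψ n⟩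
  let 𝒜 := lp (fun n => H n →L[ℂ] H n) ∞
  let _ : PartialOrder 𝒜 := CStarAlgebra.spectralOrder 𝒜
  have _ : StarOrderedRing 𝒜 := CStarAlgebra.spectralOrderedRing 𝒜
  let U : Ultrafilter ℕ := hyperfilter ℕ
  have hU : (U : Filter ℕ) ≤ atTop := Nat.hyperfilter_le_atTop
  have hex : ∀ T : 𝒜, ∃ l : ℂ, Tendsto (fun n => ⟪ψ n, T n (ψ n)⟫_ℂ) U (𝓝 l) := fun T => by
    obtain ⟨l, -, hl⟩ := (isCompact_closedBall (0 : ℂ) ‖T‖).ultrafilter_le_nhds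
      (U.map fun n => ⟪ψ n, T n (ψ n)⟫_ℂ) (by
        rw [le_principal_iff]
        refine Ultrafilter.mem_map.2 (Eventually.of_forall fun n => ?_)
        refine mem_closedBall_zero_iff.2 ?_
        calc ‖⟪ψ n, T n (ψ n)⟫_ℂ‖ ≤ ‖ψ n‖ * (‖T n‖ * ‖ψ n‖) :=
              (norm_inner_le_norm _ _).trans (by gcongr; exact (T n).le_opNorm _)
          _ ≤ ‖T‖ := by
            rw [hψ, one_mul, mul_one]; exact lp.norm_apply_le_norm ENNReal.top_ne_zero T n)
    exact ⟨l, hl⟩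
  choose φ hφ using hex
  let φl : 𝒜 →ₗ[ℂ] ℂ :=
    { toFun := φ
      map_add' := fun S T => tendsto_nhds_unique (hφ (S + T))
        (((hφ S).add (hφ T)).congr fun n => (inner_add_right _ _ _).symm)
      map_smul' := fun c T => tendsto_nhds_unique (hφ (c • T))
        (((hφ T).const_mul c).congr fun n => (inner_smul_right _ _ _).symm) }
  let φp : 𝒜 →ₚ[ℂ] ℂ := PositiveLinearMap.mk₀ φl fun T hT => by
    obtain ⟨C, rfl⟩ := CStarAlgebra.exists_eq_star_mul_self hT
    refine ge_of_tendsto' (hφ (star C * C)) fun n => ?_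
    exact (isPositive_star_mul_self (C n)).inner_nonneg_right (ψ n)
  have hφ1 : φp 1 = 1 := by
    refine tendsto_nhds_unique (hφ 1) (tendsto_const_nhds.congr fun n => ?_)
    simp [hψ n]
  -- square roots of the effects are bounded, so each effect is a square in the algebra of sequences
  have key : ∀ A : ∀ n, Fin k → Fin m → H n →L[ℂ] H n, (∀ n x, IsPOVM (A n x)) →
      ∃ A' : Fin k → Fin m → 𝒜, (∀ x, IsStarPOVM (A' x)) ∧ ∀ x a n, A' x a n = A n x a := by
    intro A hA
    have hC : ∀ n x a, ∃ C : H n →L[ℂ] H n, A n x a = star C * C := fun n x a =>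
      ((hA n x).1 a).exists_eq_star_mul_self
    choose C hC using hC
    have hC1 : ∀ n x a, ‖C n x a‖ ≤ 1 := fun n x a => by
      have h1 : ‖A n x a‖ ≤ 1 := (CStarAlgebra.norm_le_one_iff_of_nonneg _
        ((ContinuousLinearMap.nonneg_iff_isPositive _).2 ((hA n x).1 a))).2 ((hA n x).le_one a)
      rw [hC, CStarRing.norm_star_mul_self, ← sq] at h1
      exact (sq_le_one_iff₀ (norm_nonneg _)).1 h1
    let c : Fin k → Fin m → 𝒜 := fun x a => ⟨fun n => C n x a, memℓp_infty ⟨1, by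
      rintro _ ⟨n, rfl⟩; exact hC1 n x a⟩⟩
    have hc : ∀ x a n, (star (c x a) * c x a) n = A n x a := fun x a n => (hC n x a).symm
    refine ⟨fun x a => star (c x a) * c x a, fun x => ⟨fun a => ⟨c x a, 0, by simp⟩, ?_⟩, hc⟩
    refine lp.ext (funext fun n => ?_)
    rw [lp.coeFn_sum, Finset.sum_apply]
    simp only [hc]
    exact (hA n x).2
  obtain ⟨A', hA', hAA⟩ := key A hA
  obtain ⟨B', hB', hBB⟩ := key B hB
  refine mem_commutingCorrelations_of_state φp hφ1 A' B' hA' hB' (fun x y a b => ?_) P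
    fun a b x y => ?_
  · refine lp.ext (funext fun n => ?_)
    rw [lp.infty_coeFn_mul, lp.infty_coeFn_mul, Pi.mul_apply, Pi.mul_apply, hAA, hBB, hAB]
  · have h1 : Tendsto (fun n => (Q n a b x y : ℂ)) U (𝓝 (P a b x y : ℂ)) := by
      refine (Complex.continuous_ofReal.tendsto _).comp (Tendsto.mono_left ?_ hU)
      have h := tendsto_pi_nhds.1 hlim a
      exact tendsto_pi_nhds.1 (tendsto_pi_nhds.1 (tendsto_pi_nhds.1 h b) x) y
    refine tendsto_nhds_unique (h1.congr fun n => ?_) (hφ (A' x a * B' y b))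
    rw [hQP, lp.infty_coeFn_mul, Pi.mul_apply, hAA, hBB, mul_apply_eq_comp]

/-! ### Tensor product correlations are commuting correlations -/

/-- `S ↦ S ⊗ 1` as a `*`-homomorphism. -/
def opTensorLeft (H K : Type*) [NormedAddCommGroup H] [InnerProductSpace ℂ H] [CompleteSpace H]
    [NormedAddCommGroup K] [InnerProductSpace ℂ K] [CompleteSpace K] :
    (H →L[ℂ] H) →⋆ₐ[ℂ] (HilbertTensor H K →L[ℂ] HilbertTensor H K) where
  toFun S := opTensor S 1
  map_one' := opTensor_one
  map_mul' S S' := by rw [← opTensor_mul, one_mul]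
  map_zero' := by simpa using opTensor_smul_left (0 : ℂ) (0 : H →L[ℂ] H) (1 : K →L[ℂ] K)
  map_add' S S' := opTensor_add_left S S' 1
  commutes' c := by
    rw [Algebra.algebraMap_eq_smul_one, opTensor_smul_left, opTensor_one,
      Algebra.algebraMap_eq_smul_one]
  map_star' S := by rw [← opTensor_star, star_one]

/-- `T ↦ 1 ⊗ T` as a `*`-homomorphism. -/
def opTensorRight (H K : Type*) [NormedAddCommGroup H] [InnerProductSpace ℂ H] [CompleteSpace H]
    [NormedAddCommGroup K] [InnerProductSpace ℂ K] [CompleteSpace K] :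
    (K →L[ℂ] K) →⋆ₐ[ℂ] (HilbertTensor H K →L[ℂ] HilbertTensor H K) where
  toFun T := opTensor 1 T
  map_one' := opTensor_one
  map_mul' T T' := by rw [← opTensor_mul, one_mul]
  map_zero' := by simpa using opTensor_smul_right (0 : ℂ) (1 : H →L[ℂ] H) (0 : K →L[ℂ] K)
  map_add' T T' := opTensor_add_right 1 T T'
  commutes' c := by
    rw [Algebra.algebraMap_eq_smul_one, opTensor_smul_right, opTensor_one,
      Algebra.algebraMap_eq_smul_one]
  map_star' T := by rw [← opTensor_star, star_one]

theorem opTensorLeft_mul_opTensorRight {H K : Type*} [NormedAddCommGroup H]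
    [InnerProductSpace ℂ H] [CompleteSpace H] [NormedAddCommGroup K] [InnerProductSpace ℂ K]
    [CompleteSpace K] (S : H →L[ℂ] H) (T : K →L[ℂ] K) :
    opTensorLeft H K S * opTensorRight H K T = opTensor S T := by
  change opTensor S 1 * opTensor 1 T = _
  rw [← opTensor_mul, mul_one, one_mul]

theorem opTensorRight_mul_opTensorLeft {H K : Type*} [NormedAddCommGroup H]
    [InnerProductSpace ℂ H] [CompleteSpace H] [NormedAddCommGroup K] [InnerProductSpace ℂ K]
    [CompleteSpace K] (S : H →L[ℂ] H) (T : K →L[ℂ] K) :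
    opTensorRight H K T * opTensorLeft H K S = opTensor S T := by
  change opTensor 1 T * opTensor S 1 = _
  rw [← opTensor_mul, mul_one, one_mul]

theorem tensorCorrelations_subset_commutingCorrelations (k m : ℕ) :
    tensorCorrelations k m ⊆ commutingCorrelations k m := by
  rintro P ⟨HA, _, _, _, HB, _, _, _, A, B, ψ, hA, hB, hψ, hP⟩
  refine ⟨HilbertTensor HA HB, inferInstance, inferInstance, inferInstance,
    fun x a => opTensorLeft HA HB (A x a), fun y b => opTensorRight HA HB (B y b), ψ,
    fun x => (hA x).isStarPOVM.isPOVM_map _, fun y => (hB y).isStarPOVM.isPOVM_map _,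
    fun x y a b => ?_, hψ, fun a b x y => ?_⟩
  · rw [opTensorLeft_mul_opTensorRight, opTensorRight_mul_opTensorLeft]
  · rw [hP, ← mul_apply_eq_comp, opTensorLeft_mul_opTensorRight]

/-! ### Tensor product correlations form a convex set -/

section Isometry

variable {H K H' K' : Type*} [NormedAddCommGroup H] [InnerProductSpace ℂ H]
  [NormedAddCommGroup K] [InnerProductSpace ℂ K] [NormedAddCommGroup H'] [InnerProductSpace ℂ H']
  [NormedAddCommGroup K'] [InnerProductSpace ℂ K']

/-- The isometry `i ⊗ j` of Hilbert space tensor products. -/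
def isometryTensor (i : H →ₗᵢ[ℂ] H') (j : K →ₗᵢ[ℂ] K') :
    HilbertTensor H K →L[ℂ] HilbertTensor H' K' :=
  (TensorProduct.mapL i.toContinuousLinearMap j.toContinuousLinearMap).completion

theorem isometryTensor_coe (i : H →ₗᵢ[ℂ] H') (j : K →ₗᵢ[ℂ] K') (z : H ⊗[ℂ] K) :
    isometryTensor i j (toHilbertTensor H K z) =
      toHilbertTensor H' K' (TensorProduct.mapIsometry i j z) := by
  refine ((TensorProduct.mapL i.toContinuousLinearMap
    j.toContinuousLinearMap).completion_apply_coe z).trans ?_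
  rw [TensorProduct.mapL_apply]
  rfl

theorem norm_isometryTensor (i : H →ₗᵢ[ℂ] H') (j : K →ₗᵢ[ℂ] K') (z : HilbertTensor H K) :
    ‖isometryTensor i j z‖ = ‖z‖ := by
  refine hilbertTensor_induction z (isClosed_eq (by fun_prop) (by fun_prop)) fun w => ?_
  rw [isometryTensor_coe, LinearIsometry.norm_map, LinearIsometry.norm_map,
    LinearIsometry.norm_map]

theorem inner_isometryTensor (i : H →ₗᵢ[ℂ] H') (j : K →ₗᵢ[ℂ] K') (z w : HilbertTensor H K) :
    ⟪isometryTensor i j z, isometryTensor i j w⟫_ℂ = ⟪z, w⟫_ℂ :=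
  ({ (isometryTensor i j).toLinearMap with norm_map' := norm_isometryTensor i j } :
    HilbertTensor H K →ₗᵢ[ℂ] HilbertTensor H' K').inner_map_map z w

theorem opTensor_isometryTensor (i : H →ₗᵢ[ℂ] H') (j : K →ₗᵢ[ℂ] K') {S : H →L[ℂ] H}
    {S' : H' →L[ℂ] H'} {T : K →L[ℂ] K} {T' : K' →L[ℂ] K'} (hS : ∀ x, S' (i x) = i (S x))
    (hT : ∀ y, T' (j y) = j (T y)) (z : HilbertTensor H K) :
    opTensor S' T' (isometryTensor i j z) = isometryTensor i j (opTensor S T z) := by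
  refine hilbertTensor_induction z (isClosed_eq (by fun_prop) (by fun_prop)) fun w => ?_
  rw [isometryTensor_coe, opTensor_coe, opTensor_coe, isometryTensor_coe]
  congr 1
  induction w using TensorProduct.induction_on with
  | zero => simp
  | add x y hx hy => simp only [map_add, hx, hy]
  | tmul x y => simp [hS, hT]

theorem inner_isometryTensor_eq_zero {H₂ K₂ : Type*} [NormedAddCommGroup H₂]
    [InnerProductSpace ℂ H₂] [NormedAddCommGroup K₂] [InnerProductSpace ℂ K₂]
    (i : H →ₗᵢ[ℂ] H') (j : K →ₗᵢ[ℂ] K') (i₂ : H₂ →ₗᵢ[ℂ] H') (j₂ : K₂ →ₗᵢ[ℂ] K')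
    (h : ∀ x y, ⟪i x, i₂ y⟫_ℂ = 0) (z : HilbertTensor H K) (w : HilbertTensor H₂ K₂) :
    ⟪isometryTensor i j z, isometryTensor i₂ j₂ w⟫_ℂ = 0 := by
  refine hilbertTensor_induction z (isClosed_eq (by fun_prop) (by fun_prop)) fun z => ?_
  refine hilbertTensor_induction w (isClosed_eq (by fun_prop) (by fun_prop)) fun w => ?_
  rw [isometryTensor_coe, isometryTensor_coe, LinearIsometry.inner_map_map]
  induction z using TensorProduct.induction_on with
  | zero => simp
  | add x y hx hy => simp only [map_add, inner_add_left, hx, hy, add_zero]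
  | tmul x y =>
    induction w using TensorProduct.induction_on with
    | zero => simp
    | add x y hx hy => simp only [map_add, inner_add_right, hx, hy, add_zero]
    | tmul x' y' => simp [h]

end Isometry

section DirectSum

variable (H K : Type*) [NormedAddCommGroup H] [InnerProductSpace ℂ H]
  [NormedAddCommGroup K] [InnerProductSpace ℂ K]

/-- The inclusion of the first summand in the Hilbert space direct sum. -/
def directSumInl : H →ₗᵢ[ℂ] WithLp 2 (H × K) where
  toLinearMap := (WithLp.linearEquiv 2 ℂ (H × K)).symm.toLinearMap ∘ₗ LinearMap.inl ℂ H K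
  norm_map' x := WithLp.norm_toLp_fst 2 H K x

/-- The inclusion of the second summand in the Hilbert space direct sum. -/
def directSumInr : K →ₗᵢ[ℂ] WithLp 2 (H × K) where
  toLinearMap := (WithLp.linearEquiv 2 ℂ (H × K)).symm.toLinearMap ∘ₗ LinearMap.inr ℂ H K
  norm_map' x := WithLp.norm_toLp_snd 2 H K x

variable {H K}

theorem directSumInl_apply (x : H) : directSumInl H K x = WithLp.toLp 2 (x, 0) := rfl

theorem directSumInr_apply (y : K) : directSumInr H K y = WithLp.toLp 2 (0, y) := rfl

theorem inner_directSumInl_directSumInr (x : H) (y : K) :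
    ⟪directSumInl H K x, directSumInr H K y⟫_ℂ = 0 := by
  simp [directSumInl_apply, directSumInr_apply]

theorem inner_directSumInr_directSumInl (x : H) (y : K) :
    ⟪directSumInr H K y, directSumInl H K x⟫_ℂ = 0 := by
  simp [directSumInl_apply, directSumInr_apply]

/-- The block diagonal operator `S ⊕ T`. -/
def directSumOp (S : H →L[ℂ] H) (T : K →L[ℂ] K) : WithLp 2 (H × K) →L[ℂ] WithLp 2 (H × K) :=
  (WithLp.prodContinuousLinearEquiv 2 ℂ H K).symm.toContinuousLinearMap ∘L (S.prodMap T) ∘L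
    (WithLp.prodContinuousLinearEquiv 2 ℂ H K).toContinuousLinearMap

theorem directSumOp_inl (S : H →L[ℂ] H) (T : K →L[ℂ] K) (x : H) :
    directSumOp S T (directSumInl H K x) = directSumInl H K (S x) := by
  simp [directSumOp, directSumInl_apply]

theorem directSumOp_inr (S : H →L[ℂ] H) (T : K →L[ℂ] K) (y : K) :
    directSumOp S T (directSumInr H K y) = directSumInr H K (T y) := by
  simp [directSumOp, directSumInr_apply]

open scoped ComplexOrder in
theorem isPOVM_directSumOp [CompleteSpace H] [CompleteSpace K] {m : ℕ} {A : Fin m → H →L[ℂ] H}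
    {B : Fin m → K →L[ℂ] K} (hA : IsPOVM A) (hB : IsPOVM B) :
    IsPOVM fun a => directSumOp (A a) (B a) := by
  refine ⟨fun a => ?_, ?_⟩
  · rw [ContinuousLinearMap.isPositive_iff]
    refine ⟨fun x y => ?_, fun x => ?_⟩
    · simp [directSumOp, (hA.1 a).inner_left_eq_inner_right, (hB.1 a).inner_left_eq_inner_right]
    · simpa [directSumOp] using! add_nonneg ((hA.1 a).inner_nonneg_left x.fst)
        ((hB.1 a).inner_nonneg_left x.snd)
  · ext1 x
    have hx : x = directSumInl H K x.fst + directSumInr H K x.snd := by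
      apply WithLp.ofLp_injective
      simp [directSumInl_apply, directSumInr_apply]
      rfl
    have h1 : ∑ a, A a x.fst = x.fst := by rw [← sum_apply, hA.2, one_apply_eq_self]
    have h2 : ∑ a, B a x.snd = x.snd := by rw [← sum_apply, hB.2, one_apply_eq_self]
    rw [sum_apply, one_apply_eq_self, hx]
    simp only [map_add, directSumOp_inl, directSumOp_inr, Finset.sum_add_distrib]
    rw [← map_sum, ← map_sum]
    simp only [← hx, h1, h2]

end DirectSum

/-- A convex combination of two tensor product correlations is realized on the direct sums of the
Hilbert spaces of each party, by the vector `√s ψ ⊕ √t ψ'`. -/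
theorem convex_tensorCorrelations (k m : ℕ) : Convex ℝ (tensorCorrelations k m) := by
  rintro P ⟨H, _, _, _, K, _, _, _, A, B, ψ, hA, hB, hψ, hP⟩ P'
    ⟨H', _, _, _, K', _, _, _, A', B', ψ', hA', hB', hψ', hP'⟩ s t hs ht hst
  set J := isometryTensor (directSumInl H H') (directSumInl K K') with hJ
  set J' := isometryTensor (directSumInr H H') (directSumInr K K') with hJ'
  have key : ∀ (z w : HilbertTensor H K) (z' w' : HilbertTensor H' K'),
      ⟪(√s : ℂ) • J z + (√t : ℂ) • J' z', (√s : ℂ) • J w + (√t : ℂ) • J' w'⟫_ℂ =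
        s * ⟪z, w⟫_ℂ + t * ⟪z', w'⟫_ℂ := by
    intro z w z' w'
    have hs' : (√s : ℂ) * (√s : ℂ) = s := by rw [← Complex.ofReal_mul, Real.mul_self_sqrt hs]
    have ht' : (√t : ℂ) * (√t : ℂ) = t := by rw [← Complex.ofReal_mul, Real.mul_self_sqrt ht]
    have h1 : ⟪J z, J' w'⟫_ℂ = 0 :=
      inner_isometryTensor_eq_zero _ _ _ _ (fun x y => inner_directSumInl_directSumInr x y) _ _
    have h2 : ⟪J' z', J w⟫_ℂ = 0 :=
      inner_isometryTensor_eq_zero _ _ _ _ (fun x y => inner_directSumInr_directSumInl y x) _ _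
    have h3 : ⟪J z, J w⟫_ℂ = ⟪z, w⟫_ℂ := inner_isometryTensor _ _ _ _
    have h4 : ⟪J' z', J' w'⟫_ℂ = ⟪z', w'⟫_ℂ := inner_isometryTensor _ _ _ _
    simp only [inner_add_left, inner_add_right, inner_smul_left, inner_smul_right, h1, h2, h3, h4,
      Complex.conj_ofReal]
    linear_combination ⟪z, w⟫_ℂ * hs' + ⟪z', w'⟫_ℂ * ht'
  refine ⟨WithLp 2 (H × H'), inferInstance, inferInstance, inferInstance, WithLp 2 (K × K'),
    inferInstance, inferInstance, inferInstance, fun x a => directSumOp (A x a) (A' x a),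
    fun y b => directSumOp (B y b) (B' y b), (√s : ℂ) • J ψ + (√t : ℂ) • J' ψ',
    fun x => isPOVM_directSumOp (hA x) (hA' x), fun y => isPOVM_directSumOp (hB y) (hB' y), ?_,
    fun a b x y => ?_⟩
  · have h := key ψ ψ ψ' ψ'
    rw [inner_self_eq_norm_sq_to_K, inner_self_eq_norm_sq_to_K, inner_self_eq_norm_sq_to_K, hψ,
      hψ'] at h
    have h' : ‖(√s : ℂ) • J ψ + (√t : ℂ) • J' ψ'‖ ^ 2 = 1 := by
      have : ((‖(√s : ℂ) • J ψ + (√t : ℂ) • J' ψ'‖ ^ 2 : ℝ) : ℂ) = ((s + t : ℝ) : ℂ) := by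
        push_cast
        simpa using h
      rw [← hst]
      exact_mod_cast this
    exact (pow_eq_one_iff_of_nonneg (norm_nonneg _) two_ne_zero).1 h'
  · have h1 : opTensor (directSumOp (A x a) (A' x a)) (directSumOp (B y b) (B' y b)) (J ψ) =
        J (opTensor (A x a) (B y b) ψ) :=
      opTensor_isometryTensor _ _ (fun x => directSumOp_inl _ _ x) (fun x => directSumOp_inl _ _ x) _
    have h2 : opTensor (directSumOp (A x a) (A' x a)) (directSumOp (B y b) (B' y b)) (J' ψ') =
        J' (opTensor (A' x a) (B' y b) ψ') :=
      opTensor_isometryTensor _ _ (fun x => directSumOp_inr _ _ x) (fun x => directSumOp_inr _ _ x) _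
    rw [map_add, map_smul, map_smul, h1, h2, key, ← hP, ← hP']
    simp

/-! ### Representations of completions, group algebras and tensor products -/

/-- A representation which is dominated by a C⋆-seminorm extends to the completion. -/
theorem CStarSeminorm.exists_extension {𝒜 : Type u} [Ring 𝒜] [StarRing 𝒜] [Algebra ℂ 𝒜]
    (p : CStarSeminorm 𝒜) {H : Type*} [NormedAddCommGroup H] [InnerProductSpace ℂ H]
    [CompleteSpace H] (π : 𝒜 →⋆ₐ[ℂ] (H →L[ℂ] H)) (hπ : ∀ x, ‖π x‖ ≤ p.toSeminorm x) :
    ∃ π' : p.CStarCompletion →⋆ₐ[ℂ] (H →L[ℂ] H), ∀ x, π' (p.toCompletion x) = π x := by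
  let f : p.Space →+ (H →L[ℂ] H) := ⟨⟨fun x => π x, map_zero π⟩, fun x y => map_add π x y⟩
  have hf : UniformContinuous f :=
    AddMonoidHomClass.uniformContinuous_of_bound f 1 fun x => by rw [one_mul]; exact hπ x
  let F : p.CStarCompletion → (H →L[ℂ] H) := Completion.extension (α := p.Space) f
  have hF : Continuous F := Completion.continuous_extension
  have hFc : ∀ x, F (p.toCompletion x) = π x := fun x => Completion.extension_coe hf x
  have hmul : ∀ x y, F (x * y) = F x * F y := fun x y => by
    refine p.completion_induction x (isClosed_eq (by fun_prop) (by fun_prop)) fun a => ?_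
    refine p.completion_induction y (isClosed_eq (by fun_prop) (by fun_prop)) fun b => ?_
    rw [← p.toCompletion_mul, hFc, hFc, hFc, map_mul]
  have hadd : ∀ x y, F (x + y) = F x + F y := fun x y => by
    refine p.completion_induction x (isClosed_eq (by fun_prop) (by fun_prop)) fun a => ?_
    refine p.completion_induction y (isClosed_eq (by fun_prop) (by fun_prop)) fun b => ?_
    rw [← p.toCompletion_add, hFc, hFc, hFc, map_add]
  have hstar : ∀ x, F (star x) = star (F x) := fun x => by
    refine p.completion_induction x (isClosed_eq (by fun_prop) (by fun_prop)) fun a => ?_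
    rw [p.star_toCompletion, hFc, hFc, map_star]
  have hscalar : ∀ c : ℂ, F (algebraMap ℂ _ c) = algebraMap ℂ _ c := fun c => by
    rw [Algebra.algebraMap_eq_smul_one, ← p.toCompletion_one, ← p.toCompletion_smul, hFc, map_smul,
      map_one, Algebra.algebraMap_eq_smul_one]
  exact ⟨{ toFun := F, map_one' := by simpa using hscalar 1, map_mul' := hmul,
           map_zero' := by simpa using hscalar 0, map_add' := hadd, commutes' := hscalar,
           map_star' := hstar }, hFc⟩

/-- A unitary representation of `G` extends to `C⋆(G)`, and the commutant is not diminished. -/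
theorem exists_rep_maxGroupCStar {G : Type u} [Group G] {H : Type u} [NormedAddCommGroup H]
    [InnerProductSpace ℂ H] [CompleteSpace H] (ρ : G →* (H ≃ₗᵢ[ℂ] H)) :
    ∃ π : MaxGroupCStar G →⋆ₐ[ℂ] (H →L[ℂ] H),
      (∀ g v, π ((groupAlgebraMaxNorm G).toCompletion (MonoidAlgebra.single g 1)) v = ρ g v) ∧
      ∀ T : H →L[ℂ] H, (∀ g v, T (ρ g v) = ρ g (T v)) → ∀ x, Commute (π x) T := by
  let ρ' : G →* (H →L[ℂ] H) :=
    { toFun := fun g => (ρ g : H →L[ℂ] H)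
      map_one' := by rw [map_one]; rfl
      map_mul' := fun g h => by rw [map_mul]; rfl }
  let L : MonoidAlgebra ℂ G →ₐ[ℂ] (H →L[ℂ] H) := MonoidAlgebra.lift ℂ (H →L[ℂ] H) G ρ'
  have hL : ∀ g c, L (MonoidAlgebra.single g c) = c • ρ' g := fun g c =>
    MonoidAlgebra.lift_single _ _ _
  have hstar : ∀ g, star (ρ' g) = ρ' g⁻¹ := fun g => by
    rw [ContinuousLinearMap.star_eq_adjoint]
    refine ((ContinuousLinearMap.eq_adjoint_iff _ _).2 fun x y => ?_).symm
    change ⟪ρ g⁻¹ x, y⟫_ℂ = ⟪x, ρ g y⟫_ℂ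
    rw [← (ρ g).inner_map_map]
    change ⟪(ρ g * ρ g⁻¹) x, _⟫_ℂ = _
    rw [← map_mul, mul_inv_cancel, map_one]
    rfl
  let π₀ : MonoidAlgebra ℂ G →⋆ₐ[ℂ] (H →L[ℂ] H) :=
    { L with
      map_star' := fun x => by
        change L (star x) = star (L x)
        induction x using MonoidAlgebra.induction_linear with
        | zero => simp
        | add x y hx hy => rw [star_add, map_add, map_add, star_add, hx, hy]
        | single g c =>
          rw [groupAlgebra_star_single, hL, hL, star_smul, hstar]
          rfl }
  have hπ₀ : ∀ x, ‖π₀ x‖ ≤ (groupAlgebraMaxNorm G).toSeminorm x := fun x => by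
    obtain ⟨C, hC⟩ := exists_bound_groupAlgebra x
    exact le_ciSup (f := fun R : HilbertRep (MonoidAlgebra ℂ G) => ‖R.hom x‖)
      ⟨C, by rintro _ ⟨R, rfl⟩; exact hC R⟩ ⟨H, π₀⟩
  obtain ⟨π, hπ⟩ := (groupAlgebraMaxNorm G).exists_extension π₀ hπ₀
  refine ⟨π, fun g v => ?_, fun T hT x => ?_⟩
  · rw [hπ]
    change L _ v = _
    rw [hL, one_smul]
    rfl
  · have hc : Continuous π := (NonUnitalStarAlgHom.norm_apply_le π |> fun h =>
      AddMonoidHomClass.continuous_of_bound π 1 fun x => by simpa using h x)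
    refine CStarSeminorm.completion_induction _ x
      (isClosed_eq (hc.mul_const T) (hc.const_mul T)) fun a => ?_
    rw [hπ]
    change L a * T = T * L a
    induction a using MonoidAlgebra.induction_linear with
    | zero => simp
    | add x y hx hy => rw [map_add, add_mul, mul_add, hx, hy]
    | single g c =>
      rw [hL]
      ext v
      simpa using! congrArg (c • ·) (hT g v).symm

/-- Commuting representations of `A` and `B` define a representation of `A ⊗ B`. -/
theorem exists_rep_tensor {A B : Type u} [CStarAlgebra A] [CStarAlgebra B] {H : Type u}
    [NormedAddCommGroup H] [InnerProductSpace ℂ H] [CompleteSpace H]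
    (π : A →⋆ₐ[ℂ] (H →L[ℂ] H)) (ρ : B →⋆ₐ[ℂ] (H →L[ℂ] H)) (h : ∀ a b, Commute (π a) (ρ b)) :
    ∃ σ : A ⊗[ℂ] B →⋆ₐ[ℂ] (H →L[ℂ] H), ∀ a b, σ (a ⊗ₜ b) = π a * ρ b := by
  let L : A ⊗[ℂ] B →ₐ[ℂ] (H →L[ℂ] H) :=
    Algebra.TensorProduct.lift (π : A →ₐ[ℂ] (H →L[ℂ] H)) (ρ : B →ₐ[ℂ] (H →L[ℂ] H)) h
  have hL : ∀ a b, L (a ⊗ₜ b) = π a * ρ b := fun a b => Algebra.TensorProduct.lift_tmul _ _ _ _ _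
  exact ⟨{ L with
    map_star' := fun x => by
      change L (star x) = star (L x)
      induction x using TensorProduct.induction_on with
      | zero => simp
      | add x y hx hy => rw [star_add, map_add, map_add, star_add, hx, hy]
      | tmul a b =>
        rw [TensorProduct.star_tmul, hL, hL, star_mul, map_star, map_star, ← map_star, ← map_star]
        exact h _ _ }, hL⟩

/-! ### Many unitaries inside one representation of the free group on two generators -/

/-- The elements `u⁻ʲ v uʲ` of the free group on `u`, `v`. -/
def freeConj (j : ℕ) : FreeGroup (Fin 2) :=
  (FreeGroup.of 0 ^ j)⁻¹ * FreeGroup.of 1 * FreeGroup.of 0 ^ j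

/-- The canonical unitary of `C⋆(F₂)` attached to an element of `F₂`. -/
def groupUnitary (g : FreeGroup (Fin 2)) : MaxGroupCStar (FreeGroup (Fin 2)) :=
  (groupAlgebraMaxNorm (FreeGroup (Fin 2))).toCompletion (MonoidAlgebra.single g 1)

theorem star_groupUnitary (g : FreeGroup (Fin 2)) :
    star (groupUnitary g) = groupUnitary g⁻¹ := by
  rw [groupUnitary, CStarSeminorm.star_toCompletion, groupAlgebra_star_single, map_one]
  rfl

theorem groupUnitary_inv_mul (g : FreeGroup (Fin 2)) :
    groupUnitary g⁻¹ * groupUnitary g = 1 := by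
  rw [groupUnitary, groupUnitary, ← CStarSeminorm.toCompletion_mul,
    MonoidAlgebra.single_mul_single, inv_mul_cancel, one_mul, ← MonoidAlgebra.one_def,
    CStarSeminorm.toCompletion_one]

theorem commute_freeGroupLift {α M : Type*} [Group M] (f : α → M) {t : M}
    (h : ∀ i, Commute (f i) t) (g : FreeGroup α) : Commute (FreeGroup.lift f g) t := by
  induction g using FreeGroup.induction_on with
  | C1 => simp
  | of i => simpa using h i
  | inv_of i hi => simpa using hi.inv_left
  | mul x y hx hy => rw [map_mul]; exact hx.mul_left hy

section Shift

variable {H : Type*} [NormedAddCommGroup H] [InnerProductSpace ℂ H] {N : ℕ} [NeZero N]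

variable (H N) in
/-- The Hilbert space `H ⊗ ℓ²(ℤ/N) ⊗ ℓ²(ℤ/N)`, as a direct sum of copies of `H`. -/
abbrev ShiftSpace : Type _ := PiLp 2 fun _ : ZMod N × ZMod N => H

variable (H N) in
/-- The inclusion of the copy of `H` with index `(0, 0)`. -/
def shiftIncl : H →ₗᵢ[ℂ] ShiftSpace H N where
  toFun h := PiLp.single 2 (0, 0) h
  map_add' _ _ := PiLp.single_add _ _
  map_smul' c x := WithLp.ofLp_injective 2 (Pi.single_smul' (0, 0) c x)
  norm_map' _ := PiLp.norm_single _ _ _ _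

variable (H N) in
/-- The cyclic shift of the first index. -/
def shiftLeft : ShiftSpace H N ≃ₗᵢ[ℂ] ShiftSpace H N :=
  LinearIsometryEquiv.piLpCongrLeft 2 ℂ H ((Equiv.addRight 1).prodCongr (Equiv.refl _))

variable (H N) in
/-- The cyclic shift of the second index. -/
def shiftRight : ShiftSpace H N ≃ₗᵢ[ℂ] ShiftSpace H N :=
  LinearIsometryEquiv.piLpCongrLeft 2 ℂ H ((Equiv.refl _).prodCongr (Equiv.addRight 1))

/-- The block diagonal unitary with blocks `U i`, where `i` is the first index. -/
def diagLeft (U : ZMod N → H ≃ₗᵢ[ℂ] H) : ShiftSpace H N ≃ₗᵢ[ℂ] ShiftSpace H N :=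
  LinearIsometryEquiv.piLpCongrRight 2 fun p => U p.1

/-- The block diagonal unitary with blocks `V j`, where `j` is the second index. -/
def diagRight (V : ZMod N → H ≃ₗᵢ[ℂ] H) : ShiftSpace H N ≃ₗᵢ[ℂ] ShiftSpace H N :=
  LinearIsometryEquiv.piLpCongrRight 2 fun p => V p.2

theorem shiftLeft_pow_single (j : ℕ) (h : H) :
    (shiftLeft H N ^ j) (PiLp.single 2 (0, 0) h) = PiLp.single 2 ((j : ZMod N), 0) h := by
  induction j with
  | zero => simp
  | succ j ih =>
    rw [pow_succ']
    change shiftLeft H N ((shiftLeft H N ^ j) _) = _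
    rw [ih, shiftLeft, LinearIsometryEquiv.piLpCongrLeft_single]
    simp

theorem shiftRight_pow_single (j : ℕ) (h : H) :
    (shiftRight H N ^ j) (PiLp.single 2 (0, 0) h) = PiLp.single 2 (0, (j : ZMod N)) h := by
  induction j with
  | zero => simp
  | succ j ih =>
    rw [pow_succ']
    change shiftRight H N ((shiftRight H N ^ j) _) = _
    rw [ih, shiftRight, LinearIsometryEquiv.piLpCongrLeft_single]
    simp

/-- The representation of `F₂` by the shift and the block diagonal unitary of the first index. -/
def freeRepLeft (U : ZMod N → H ≃ₗᵢ[ℂ] H) :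
    FreeGroup (Fin 2) →* (ShiftSpace H N ≃ₗᵢ[ℂ] ShiftSpace H N) :=
  FreeGroup.lift ![shiftLeft H N, diagLeft U]

/-- The representation of `F₂` by the shift and the block diagonal unitary of the second index. -/
def freeRepRight (V : ZMod N → H ≃ₗᵢ[ℂ] H) :
    FreeGroup (Fin 2) →* (ShiftSpace H N ≃ₗᵢ[ℂ] ShiftSpace H N) :=
  FreeGroup.lift ![shiftRight H N, diagRight V]

/-- The conjugates `u⁻ʲ v uʲ` move the copy `(0, 0)` to the position `(j, 0)`, apply `U j` there, and
move it back. -/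
theorem freeRepLeft_freeConj (U : ZMod N → H ≃ₗᵢ[ℂ] H) (j : ℕ) (h : H) :
    freeRepLeft U (freeConj j) (shiftIncl H N h) = shiftIncl H N (U j h) := by
  rw [freeRepLeft, freeConj, map_mul, map_mul, map_inv, map_pow, FreeGroup.lift_apply_of,
    FreeGroup.lift_apply_of]
  change (shiftLeft H N ^ j).symm (diagLeft U ((shiftLeft H N ^ j) (PiLp.single 2 (0, 0) h))) =
    PiLp.single 2 (0, 0) (U j h)
  rw [LinearIsometryEquiv.symm_apply_eq, shiftLeft_pow_single, shiftLeft_pow_single, diagLeft,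
    LinearIsometryEquiv.piLpCongrRight_single]

theorem freeRepRight_freeConj (V : ZMod N → H ≃ₗᵢ[ℂ] H) (j : ℕ) (h : H) :
    freeRepRight V (freeConj j) (shiftIncl H N h) = shiftIncl H N (V j h) := by
  rw [freeRepRight, freeConj, map_mul, map_mul, map_inv, map_pow, FreeGroup.lift_apply_of,
    FreeGroup.lift_apply_of]
  change (shiftRight H N ^ j).symm (diagRight V ((shiftRight H N ^ j) (PiLp.single 2 (0, 0) h))) =
    PiLp.single 2 (0, 0) (V j h)
  rw [LinearIsometryEquiv.symm_apply_eq, shiftRight_pow_single, shiftRight_pow_single, diagRight,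
    LinearIsometryEquiv.piLpCongrRight_single]

theorem commute_freeRep (U V : ZMod N → H ≃ₗᵢ[ℂ] H) (hUV : ∀ i j v, U i (V j v) = V j (U i v))
    (g g' : FreeGroup (Fin 2)) : Commute (freeRepLeft U g) (freeRepRight V g') := by
  refine commute_freeGroupLift _ (fun i => (commute_freeGroupLift _ (fun j => ?_) g').symm) g
  fin_cases i <;> fin_cases j <;> refine LinearIsometryEquiv.ext fun w => PiLp.ext fun p => ?_
  · rfl
  · rfl
  · rfl
  · exact (hUV p.1 p.2 (w p)).symm

end Shift

/-! ### Universal POVMs in the group C⋆-algebra -/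

/-- The numbering of the pairs (setting, outcome) by `0, …, km - 1`. -/
def pairIndex {k m : ℕ} (x : Fin k) (a : Fin m) : ℕ := (finProdFinEquiv (x, a) : Fin (k * m))

/-- A family indexed by pairs (setting, outcome), as a family indexed by `ℤ/(km + 1)`; the modulus
exceeds `km` in order to be nonzero. The spare indices get the value `d`, and a property `p` shared by
`d` and all members persists. -/
theorem exists_zmod_family {k m : ℕ} {α : Type*} (U : Fin k → Fin m → α) (d : α) (p : α → Prop)
    (hU : ∀ x a, p (U x a)) (hd : p d) :
    ∃ U' : ZMod (k * m + 1) → α, (∀ x a, U' (pairIndex x a) = U x a) ∧ ∀ i, p (U' i) := by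
  refine ⟨fun i => if h : i.val < k * m then
    U (finProdFinEquiv.symm ⟨i.val, h⟩).1 (finProdFinEquiv.symm ⟨i.val, h⟩).2 else d,
    fun x a => ?_, fun i => ?_⟩
  · have hlt : pairIndex x a < k * m := (finProdFinEquiv (x, a)).2
    have hv : ((pairIndex x a : ℕ) : ZMod (k * m + 1)).val = pairIndex x a :=
      ZMod.val_natCast_of_lt (Nat.lt_succ_of_lt hlt)
    have h2 : finProdFinEquiv.symm ⟨pairIndex x a, hlt⟩ = (x, a) :=
      finProdFinEquiv.symm_apply_apply (x, a)
    simp only [hv, hlt, dif_pos, h2]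
  · dsimp only
    split_ifs
    · exact hU _ _
    · exact hd

/-- There are POVMs in `C⋆(F₂)` which realize all commuting correlations, through representations of
the algebraic tensor product: each effect of the given POVMs is `(2 + U + U⋆) / 4` for a unitary `U`
in its bicommutant, and these unitaries are all contained in one representation of `F₂ × F₂`. -/
theorem exists_universal_povm (k m : ℕ) [NeZero m] :
    ∃ E : Fin k → Fin m → MaxGroupCStar (FreeGroup (Fin 2)), (∀ x, IsStarPOVM (E x)) ∧
      ∀ P ∈ commutingCorrelations k m,
        ∃ σ : HilbertRep (MaxGroupCStar (FreeGroup (Fin 2)) ⊗[ℂ] MaxGroupCStar (FreeGroup (Fin 2))),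
        ∃ ξ : σ.carrier, ‖ξ‖ = 1 ∧
          ∀ a b x y, (P a b x y : ℂ) = ⟪ξ, σ.hom (E x a ⊗ₜ E y b) ξ⟫_ℂ := by
  let g : Fin k → Fin m → FreeGroup (Fin 2) := fun x a => freeConj (pairIndex x a)
  let r : Fin k → Fin m → MaxGroupCStar (FreeGroup (Fin 2)) := fun x a =>
    (2⁻¹ : ℂ) • (1 + groupUnitary (g x a))
  have hr : ∀ x a, star (r x a) * r x a =
      (4⁻¹ : ℂ) • (2 + groupUnitary (g x a) + groupUnitary (g x a)⁻¹) := fun x a => by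
    have h := groupUnitary_inv_mul (g x a)
    have e : star (2⁻¹ : ℂ) = 2⁻¹ := by rw [← starRingEnd_apply, map_inv₀, Complex.conj_ofNat]
    simp only [r, star_smul, star_add, star_one, star_groupUnitary, smul_mul_assoc, mul_smul_comm,
      add_mul, mul_add, one_mul, mul_one, h, e]
    rw [← smul_add, smul_smul, ← one_add_one_eq_two (R := MaxGroupCStar (FreeGroup (Fin 2)))]
    congr 1
    · norm_num
    · abel
  -- on the copy of `H`, the elements `r⋆ r` act as the given effects; `E` repairs them elsewhere
  choose E hE hEr using fun x => exists_isStarPOVM_of_tuple (r x)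
  refine ⟨E, hE, ?_⟩
  rintro P ⟨H, _, _, _, A, B, ψ, hA, hB, hAB, hψ, hP⟩
  have hpos : ∀ {C : Fin k → Fin m → H →L[ℂ] H}, (∀ x, IsPOVM (C x)) → ∀ x a, 0 ≤ C x a :=
    fun hC x a => (ContinuousLinearMap.nonneg_iff_isPositive _).2 ((hC x).1 a)
  choose U hUA hUc using fun x a =>
    exists_unitary_of_nonneg_of_le_one (hpos hA x a) ((hA x).le_one a)
  choose V hVB hVc using fun y b =>
    exists_unitary_of_nonneg_of_le_one (hpos hB y b) ((hB y).le_one b)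
  have hUV : ∀ x a y b, Commute (U x a) (V y b) := fun x a y b => by
    have h1 : Commute (A x a) (V y b : H →L[ℂ] H) :=
      (hVc y b _ (hAB x y a b).symm).symm
    exact Subtype.ext (hUc x a _ h1)
  -- pass to families indexed by `ℤ/(km + 1)`, first for `V`, then for `U`, keeping commutation
  let Φ := Unitary.linearIsometryEquiv (𝕜 := ℂ) (H := H)
  obtain ⟨V', hV', hVU'⟩ := exists_zmod_family (fun y b => Φ (V y b)) 1
    (fun w => ∀ x a, Commute (Φ (U x a)) w)
    (fun y b x a => (hUV x a y b).map Φ) (fun x a => Commute.one_right _)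
  obtain ⟨U', hU', hUV'⟩ := exists_zmod_family (fun x a => Φ (U x a)) 1
    (fun w => ∀ j, Commute w (V' j)) (fun x a j => hVU' j x a) (fun j => Commute.one_left _)
  have hc := commute_freeRep U' V' fun i j v => congrArg (fun e => e v) (hUV' i j)
  obtain ⟨π, hπ, hπc⟩ := exists_rep_maxGroupCStar (freeRepLeft U')
  obtain ⟨ρ, hρ, hρc⟩ := exists_rep_maxGroupCStar (freeRepRight V')
  have hcomm : ∀ a b, Commute (π a) (ρ b) := fun a b => by
    refine hπc (ρ b) (fun g v => ?_) a
    have h := hρc (freeRepLeft U' g : ShiftSpace H (k * m + 1) →L[ℂ] ShiftSpace H (k * m + 1))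
      (fun g' v => congrArg (fun e => e v) (hc g g')) b
    exact congrArg (fun T => T v) h
  obtain ⟨σ, hσ⟩ := exists_rep_tensor π ρ hcomm
  let ι := shiftIncl H (k * m + 1)
  -- both parties use the same `E`; this is the part of the computation they share
  have hact : ∀ (τ : FreeGroup (Fin 2) →*
      (ShiftSpace H (k * m + 1) ≃ₗᵢ[ℂ] ShiftSpace H (k * m + 1)))
      (θ : MaxGroupCStar (FreeGroup (Fin 2)) →⋆ₐ[ℂ]
        (ShiftSpace H (k * m + 1) →L[ℂ] ShiftSpace H (k * m + 1)))
      (_ : ∀ g v, θ (groupUnitary g) v = τ g v)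
      (W : Fin k → Fin m → unitary (H →L[ℂ] H)) (C : Fin k → Fin m → H →L[ℂ] H)
      (_ : ∀ x a, (4⁻¹ : ℂ) • (2 + (W x a : H →L[ℂ] H) + star (W x a : H →L[ℂ] H)) = C x a)
      (_ : ∀ x, IsPOVM (C x)) (_ : ∀ x a h, τ (g x a) (ι h) = ι (Φ (W x a) h)),
      ∀ x a h, θ (E x a) (ι h) = ι (C x a h) := by
    intro τ θ hθ W C hW hC hτ x
    refine hEr x θ ι.toLinearMap (C x) (hC x).2 fun a h => ?_
    have hinv : τ (g x a)⁻¹ (ι h) = ι ((star (W x a : H →L[ℂ] H)) h) := by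
      rw [map_inv]
      change (τ (g x a)).symm (ι h) = _
      rw [LinearIsometryEquiv.symm_apply_eq, hτ]
      change ι h = ι (((W x a : H →L[ℂ] H) * star (W x a : H →L[ℂ] H)) h)
      rw [Unitary.mul_star_self_of_mem (W x a).2, one_apply_eq_self]
    change θ _ (ι h) = ι (C x a h)
    have h2 : θ 2 (ι h) = ι ((2 : H →L[ℂ] H) h) := by
      have e1 : θ 2 = 1 + 1 := by rw [map_ofNat, one_add_one_eq_two]
      have e2 : (2 : H →L[ℂ] H) = 1 + 1 := one_add_one_eq_two.symm
      rw [e1, e2, add_apply, add_apply, map_add, one_apply_eq_self, one_apply_eq_self]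
    rw [hr, map_smul, map_add, map_add, smul_apply, add_apply, add_apply, hθ, hθ, hτ, hinv, h2,
      ← hW, smul_apply, add_apply, add_apply, map_smul, map_add, map_add]
    rfl
  have hπE := hact _ π hπ U A hUA hA fun x a h => by
    rw [← hU']; exact freeRepLeft_freeConj U' _ h
  have hρE := hact _ ρ hρ V B hVB hB fun y b h => by
    rw [← hV']; exact freeRepRight_freeConj V' _ h
  refine ⟨⟨ShiftSpace H (k * m + 1), σ⟩, ι ψ, (ι.norm_map ψ).trans hψ, fun a b x y => ?_⟩
  change _ = ⟪ι ψ, σ (E x a ⊗ₜ E y b) (ι ψ)⟫_ℂ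
  rw [hσ, mul_apply_eq_comp, hρE, hπE, ι.inner_map_map, hP]

/-! ### Separating a correlation from the tensor product correlations -/

theorem MinTensorEqMaxTensor.maxTensorNorm_eq {A B : Type u} [CStarAlgebra A] [CStarAlgebra B]
    (h : MinTensorEqMaxTensor A B) (x : A ⊗[ℂ] B) :
    (maxTensorNorm A B).toSeminorm x = (minTensorNorm A B).toSeminorm x := by
  obtain ⟨e, he⟩ := h
  rw [← CStarSeminorm.norm_toCompletion, ← CStarSeminorm.norm_toCompletion, ← he]
  exact NonUnitalStarAlgHom.norm_map e e.injective _

/-- The norm of a positive operator is determined by its quadratic form on unit vectors. -/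
theorem norm_le_of_forall_inner_mem_Icc {H : Type*} [NormedAddCommGroup H] [InnerProductSpace ℂ H]
    [CompleteSpace H] {T : H →L[ℂ] H} (hT : IsSelfAdjoint T) {r : ℝ} (hr : 0 ≤ r)
    (h : ∀ ξ, ‖ξ‖ = 1 → (⟪ξ, T ξ⟫_ℂ).re ∈ Set.Icc 0 r) : ‖T‖ ≤ r := by
  have h' : ∀ ξ, (⟪ξ, T ξ⟫_ℂ).re ∈ Set.Icc 0 (r * ‖ξ‖ ^ 2) := fun ξ => by
    rcases eq_or_ne ξ 0 with rfl | hξ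
    · simp
    · have hn : 0 < ‖ξ‖ := norm_pos_iff.2 hξ
      have h1 := h ((‖ξ‖⁻¹ : ℂ) • ξ) (by simp [norm_smul, hn.ne'])
      have h2 : (⟪(‖ξ‖⁻¹ : ℂ) • ξ, T ((‖ξ‖⁻¹ : ℂ) • ξ)⟫_ℂ).re = (⟪ξ, T ξ⟫_ℂ).re / ‖ξ‖ ^ 2 := by
        rw [map_smul, inner_smul_left, inner_smul_right, ← Complex.ofReal_inv, Complex.conj_ofReal,
          Complex.re_ofReal_mul, Complex.re_ofReal_mul]
        field_simp
      rw [h2] at h1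
      refine ⟨?_, (div_le_iff₀ (by positivity)).1 h1.2⟩
      have := mul_nonneg h1.1 (sq_nonneg ‖ξ‖)
      rwa [div_mul_cancel₀ _ (by positivity)] at this
  have h0 : 0 ≤ T := by
    rw [ContinuousLinearMap.nonneg_iff_isPositive, ContinuousLinearMap.isPositive_def']
    refine ⟨hT, fun ξ => ?_⟩
    rw [ContinuousLinearMap.reApplyInnerSelf_apply, inner_re_symm]
    exact (h' ξ).1
  rw [CStarAlgebra.norm_le_iff_le_algebraMap T hr h0, ContinuousLinearMap.le_def,
    ContinuousLinearMap.isPositive_def']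
  refine ⟨((IsSelfAdjoint.all r).algebraMap _).sub hT, fun ξ => ?_⟩
  rw [ContinuousLinearMap.reApplyInnerSelf_apply, inner_re_symm, sub_apply, inner_sub_right,
    Algebra.algebraMap_eq_smul_one, smul_apply, one_apply_eq_self, ← Complex.coe_smul,
    inner_smul_right, inner_self_eq_norm_sq_to_K, map_sub]
  have := (h' ξ).2
  have e : RCLike.re ((r : ℂ) * ((‖ξ‖ : ℂ)) ^ 2) = r * ‖ξ‖ ^ 2 := by
    norm_cast
  exact sub_nonneg.2 (this.trans_eq e.symm)

theorem exists_coeff_bellArray {k m : ℕ} (f : BellArray k m →ₗ[ℝ] ℝ) :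
    ∃ c : BellArray k m, ∀ P, f P = ∑ a, ∑ b, ∑ x, ∑ y, c a b x y * P a b x y := by
  have key : ∀ {ι M : Type} [Fintype ι] [DecidableEq ι] [AddCommGroup M] [Module ℝ M]
      (f : (ι → M) →ₗ[ℝ] ℝ) (v : ι → M), f v = ∑ i, (f ∘ₗ LinearMap.single ℝ (fun _ => M) i) (v i) :=
    fun f v => by
      conv_lhs => rw [← Finset.univ_sum_single v, map_sum]
      rfl
  refine ⟨fun a b x y => ((((f ∘ₗ LinearMap.single ℝ _ a) ∘ₗ LinearMap.single ℝ _ b) ∘ₗ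
    LinearMap.single ℝ _ x) ∘ₗ LinearMap.single ℝ _ y) 1, fun P => ?_⟩
  rw [key f P]
  refine Finset.sum_congr rfl fun a _ => ?_
  rw [key _ (P a)]
  refine Finset.sum_congr rfl fun b _ => ?_
  rw [key _ (P a b)]
  refine Finset.sum_congr rfl fun x _ => ?_
  rw [key _ (P a b x)]
  refine Finset.sum_congr rfl fun y _ => ?_
  rw [mul_comm, ← smul_eq_mul, ← map_smul, smul_eq_mul, mul_one]

/-- POVMs in C⋆-algebras `A`, `B`, represented on a Hilbert space tensor product, yield tensor
product correlations. -/
theorem exists_mem_tensorCorrelations {k m : ℕ} {A B : Type} [CStarAlgebra A] [CStarAlgebra B]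
    {E : Fin k → Fin m → A} {F : Fin k → Fin m → B} (hE : ∀ x, IsStarPOVM (E x))
    (hF : ∀ y, IsStarPOVM (F y)) (π : HilbertRep A) (ρ : HilbertRep B)
    {ξ : (π.tensor ρ).carrier} (hξ : ‖ξ‖ = 1) :
    ∃ P ∈ tensorCorrelations k m, ∀ a b x y,
      (P a b x y : ℂ) = ⟪ξ, (π.tensor ρ).hom (E x a ⊗ₜ F y b) ξ⟫_ℂ := by
  have hP : ∀ a b x y, ((⟪ξ, (π.tensor ρ).hom (E x a ⊗ₜ F y b) ξ⟫_ℂ).re : ℂ) =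
      ⟪ξ, (π.tensor ρ).hom (E x a ⊗ₜ F y b) ξ⟫_ℂ := fun a b x y => by
    rw [← Complex.conj_eq_iff_re, inner_conj_symm, ← ContinuousLinearMap.adjoint_inner_right,
      ← ContinuousLinearMap.star_eq_adjoint, ← map_star, TensorProduct.star_tmul, (hE x).star_eq,
      (hF y).star_eq]
  exact ⟨fun a b x y => (⟪ξ, (π.tensor ρ).hom (E x a ⊗ₜ F y b) ξ⟫_ℂ).re,
    ⟨π.carrier, inferInstance, inferInstance, inferInstance, ρ.carrier, inferInstance,
      inferInstance, inferInstance, fun x a => π.hom (E x a), fun y b => ρ.hom (F y b), ξ,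
      fun x => (hE x).isPOVM_map _, fun y => (hF y).isPOVM_map _, hξ, hP⟩, hP⟩

/-- If the minimal and the maximal norm agree, then the correlations which POVMs of `A` and `B`
produce in an arbitrary representation of `A ⊗ B` are limits of tensor product correlations.
Otherwise, a hyperplane would separate them; the element of `A ⊗ B` which represents it, shifted to
be positive, would have a maximal norm larger than its minimal norm. -/
theorem mem_closure_tensorCorrelations {k m : ℕ} {A B : Type} [CStarAlgebra A] [CStarAlgebra B]
    (h : MinTensorEqMaxTensor A B) {E : Fin k → Fin m → A} {F : Fin k → Fin m → B}
    (hE : ∀ x, IsStarPOVM (E x)) (hF : ∀ y, IsStarPOVM (F y)) (σ : HilbertRep (A ⊗[ℂ] B))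
    {ξ : σ.carrier} (hξ : ‖ξ‖ = 1) {P : BellArray k m}
    (hP : ∀ a b x y, (P a b x y : ℂ) = ⟪ξ, σ.hom (E x a ⊗ₜ F y b) ξ⟫_ℂ) :
    P ∈ closure (tensorCorrelations k m) := by
  by_contra hnot
  obtain ⟨f, u, hu, huP⟩ := geometric_hahn_banach_closed_point
    (convex_tensorCorrelations k m).closure isClosed_closure hnot
  obtain ⟨c, hc⟩ := exists_coeff_bellArray (f : BellArray k m →ₗ[ℝ] ℝ)
  let X : A ⊗[ℂ] B := ∑ a, ∑ b, ∑ x, ∑ y, (c a b x y : ℂ) • (E x a ⊗ₜ F y b)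
  have hXs : star X = X := by
    simp only [X, star_sum, star_smul, TensorProduct.star_tmul, (hE _).star_eq, (hF _).star_eq,
      ← starRingEnd_apply, Complex.conj_ofReal]
  have hX : ∀ (τ : HilbertRep (A ⊗[ℂ] B)) (η : τ.carrier) (P' : BellArray k m),
      (∀ a b x y, (P' a b x y : ℂ) = ⟪η, τ.hom (E x a ⊗ₜ F y b) η⟫_ℂ) →
      ⟪η, τ.hom X η⟫_ℂ = (f P' : ℂ) := fun τ η P' hP' => by
    have hf : f P' = ∑ a, ∑ b, ∑ x, ∑ y, c a b x y * P' a b x y := hc P'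
    rw [hf]
    simp only [X, map_sum, map_smul, sum_apply, smul_apply, inner_sum, inner_smul_right, ← hP']
    push_cast
    rfl
  obtain ⟨C, hC⟩ := HilbertRep.exists_bound_tensor X
  have hCre : ∀ (τ : HilbertRep (A ⊗[ℂ] B)) (η : τ.carrier), ‖η‖ = 1 →
      -C ≤ (⟪η, τ.hom X η⟫_ℂ).re := fun τ η hη => by
    have h1 : ‖⟪η, τ.hom X η⟫_ℂ‖ ≤ C := by
      refine (norm_inner_le_norm _ _).trans ?_
      rw [hη, one_mul]
      refine ((τ.hom X).le_opNorm η).trans ?_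
      rw [hη, mul_one]
      exact hC τ
    exact (abs_le.1 ((Complex.abs_re_le_norm _).trans h1)).1
  have hC0 : 0 ≤ C := (norm_nonneg _).trans (hC σ)
  -- the shift makes `X + D` positive in every representation, and `u + D` nonnegative
  set D : ℝ := C + |u| with hD
  have hD0 : 0 ≤ u + D := by linarith [neg_abs_le u]
  set Y : A ⊗[ℂ] B := X + (D : ℂ) • 1 with hY
  have hYs : star Y = Y := by
    rw [hY, star_add, hXs, star_smul, star_one, ← starRingEnd_apply, Complex.conj_ofReal]
  have hYre : ∀ (τ : HilbertRep (A ⊗[ℂ] B)) (η : τ.carrier), ‖η‖ = 1 →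
      (⟪η, τ.hom Y η⟫_ℂ).re = (⟪η, τ.hom X η⟫_ℂ).re + D := fun τ η hη => by
    rw [hY, map_add, map_smul, map_one, add_apply, smul_apply, one_apply_eq_self, inner_add_right,
      inner_smul_right, inner_self_eq_norm_sq_to_K, hη]
    simp
  have hmin : (minTensorNorm A B).toSeminorm Y ≤ u + D := by
    refine ciSup_le fun i => norm_le_of_forall_inner_mem_Icc ?_ hD0 fun η hη => ?_
    · rw [isSelfAdjoint_iff, ← map_star, hYs]
    · obtain ⟨P', hP'mem, hP'⟩ := exists_mem_tensorCorrelations hE hF i.1 i.2 hη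
      rw [hYre _ _ hη]
      refine ⟨by linarith [hCre _ _ hη, abs_nonneg u], ?_⟩
      rw [hX _ _ _ hP', Complex.ofReal_re]
      linarith [hu P' (subset_closure hP'mem)]
  have hmax : f P + D ≤ (maxTensorNorm A B).toSeminorm Y := by
    obtain ⟨C', hC'⟩ := HilbertRep.exists_bound_tensor Y
    calc f P + D = (⟪ξ, σ.hom Y ξ⟫_ℂ).re := by rw [hYre _ _ hξ, hX _ _ _ hP, Complex.ofReal_re]
      _ ≤ ‖⟪ξ, σ.hom Y ξ⟫_ℂ‖ := Complex.re_le_norm _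
      _ ≤ ‖ξ‖ * (‖σ.hom Y‖ * ‖ξ‖) :=
        (norm_inner_le_norm _ _).trans (by gcongr; exact (σ.hom Y).le_opNorm ξ)
      _ = ‖σ.hom Y‖ := by rw [hξ, one_mul, mul_one]
      _ ≤ _ := le_ciSup (f := fun τ : HilbertRep (A ⊗[ℂ] B) => ‖τ.hom Y‖)
        ⟨C', by rintro _ ⟨τ, rfl⟩; exact hC' τ⟩ σ
  rw [h.maxTensorNorm_eq] at hmax
  linarith

/-- Without outcomes, the correlation array is empty, and it only matters whether the POVMs exist. -/
theorem commutingCorrelations_zero_subset (k : ℕ) :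
    commutingCorrelations k 0 ⊆ tensorCorrelations k 0 := by
  rintro P ⟨H, _, _, _, A, B, ψ, hA, hB, -, hψ, -⟩
  refine ⟨H, inferInstance, inferInstance, inferInstance, H, inferInstance, inferInstance,
    inferInstance, A, B, toHilbertTensor H H (ψ ⊗ₜ ψ), hA, hB, ?_, fun a => a.elim0⟩
  rw [LinearIsometry.norm_map, TensorProduct.norm_tmul, hψ, one_mul]

end

theorem mainTheorem1 (hQWEP : QWEPConjecture) (k m : ℕ) :
    closure (tensorCorrelations k m) = commutingCorrelations k m := by
  refine (closure_minimal (tensorCorrelations_subset_commutingCorrelations k m)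
    (isClosed_commutingCorrelations k m)).antisymm fun P hP => ?_
  rcases Nat.eq_zero_or_pos m with rfl | hm
  · exact subset_closure (commutingCorrelations_zero_subset k hP)
  · have : NeZero m := ⟨hm.ne'⟩
    obtain ⟨E, hE, hEP⟩ := exists_universal_povm k m
    obtain ⟨σ, ξ, hξ, h⟩ := hEP P hP
    exact mem_closure_tensorCorrelations hQWEP hE hE σ hξ h
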